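/- Let $(M,g)$ be a smooth ($C^\infty$) $2$-dimensional Riemannian manifold and let $x : M \to \mathbb{E}^3$ be a smooth isometric immersion into Euclidean $3$-space. Let $\Delta = -\operatorname{trace}\nabla^2$ be the Laplace operator of $(M,g)$, acting componentwise on $\mathbb{E}^3$-valued maps, and let $L = \Delta x : M \to \mathbb{E}^3$ be the Laplace map of $x$. Recall that a smooth map $\phi : M \to \mathbb{E}^3$ is harmonic if its tension field $\tau(\phi) = \operatorname{trace}(\nabla d\phi)$ vanishes identically, where $(\nabla d\phi)(X,Y) = X(Y\phi) - (\nabla_X Y)\phi$ and $\nabla$ is the Levi-Civita connection of $g$; that $x$ is biharmonic if $\Delta^2 x = 0$; and that $x$ is minimal if its mean curvature vector $H = \tfrac12 \operatorname{trace} h$ vanishes identically, where the second fundamental form $h(X,Y)$ is the component of $X(Yx)$ normal to the surface. Then: 1. the Laplace map $L : M \to \mathbb{E}^3$ is a harmonic map if and only if $x$ is minimal; 2. $x$ is biharmonic if and only if $x$ is minimal. -/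

import Mathlib

open scoped Manifold ContDiff

noncomputable section

namespace LaplaceMap

/-- A smooth Riemannian metric on a smooth `n`-manifold `M`. -/
abbrev Metric (n : ℕ) (M : Type*) [TopologicalSpace M]
    [ChartedSpace (EuclideanSpace ℝ (Fin n)) M] [IsManifold (𝓡 n) ∞ M] :=
  Bundle.ContMDiffRiemannianMetric (𝓡 n) ∞ (EuclideanSpace ℝ (Fin n))
    (fun p : M => TangentSpace (𝓡 n) p)

/-- The `i`-th partial derivative of a map defined on (an open subset of) `ℝⁿ`. -/
def partialD {n : ℕ} {F : Type*} [NormedAddCommGroup F] [NormedSpace ℝ F] (i : Fin n)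
    (f : EuclideanSpace ℝ (Fin n) → F) (u : EuclideanSpace ℝ (Fin n)) : F :=
  fderiv ℝ f u (EuclideanSpace.single i 1)

section Manifold

variable {n m : ℕ} {M : Type*} [TopologicalSpace M]
  [ChartedSpace (EuclideanSpace ℝ (Fin n)) M] [IsManifold (𝓡 n) ∞ M]
  {F : Type*} [NormedAddCommGroup F] [NormedSpace ℝ F]

/-! ### Local coordinates

Throughout, `e` is a chart of `M`, and `u` is a point of its image in `ℝⁿ`. -/

/-- The coordinate vector field `∂ᵢ` of the chart `e`, at the point with coordinates `u`. -/
def coordVector (e : OpenPartialHomeomorph M (EuclideanSpace ℝ (Fin n)))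
    (u : EuclideanSpace ℝ (Fin n)) (i : Fin n) : TangentSpace (𝓡 n) (e.symm u) :=
  mfderiv (𝓡 n) (𝓡 n) e.symm u (EuclideanSpace.single i (1 : ℝ))

/-- The matrix `(g_{ij})` of the metric in the chart `e`. -/
def metricMatrix (g : Metric n M) (e : OpenPartialHomeomorph M (EuclideanSpace ℝ (Fin n)))
    (u : EuclideanSpace ℝ (Fin n)) : Matrix (Fin n) (Fin n) ℝ :=
  Matrix.of fun i j => g.inner (e.symm u) (coordVector e u i) (coordVector e u j)

/-- The Christoffel symbol `Γᵏ_{ij}` of the Levi-Civita connection of `g` in the chart `e`,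
`Γᵏ_{ij} = ½ ∑ₗ gᵏˡ (∂ᵢ g_{jl} + ∂ⱼ g_{il} - ∂ₗ g_{ij})`, so that `∇_{∂ᵢ} ∂ⱼ = ∑ₖ Γᵏ_{ij} ∂ₖ`. -/
def christoffel (g : Metric n M) (e : OpenPartialHomeomorph M (EuclideanSpace ℝ (Fin n)))
    (k i j : Fin n) (u : EuclideanSpace ℝ (Fin n)) : ℝ :=
  (1 / 2) * ∑ l, (metricMatrix g e u)⁻¹ k l *
    (partialD i (fun v => metricMatrix g e v j l) u
      + partialD j (fun v => metricMatrix g e v i l) u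
      - partialD l (fun v => metricMatrix g e v i j) u)

/-- The second fundamental form `(∇dφ)(∂ᵢ, ∂ⱼ) = ∂ᵢ(φ_* ∂ⱼ) - φ_*(∇_{∂ᵢ} ∂ⱼ)` of a map `φ` from
`(M, g)` to a vector space with its flat connection, in the chart `e`. For a real-valued function
this is its Hessian `∇²φ`. -/
def secondFundFormOfMap (g : Metric n M)
    (e : OpenPartialHomeomorph M (EuclideanSpace ℝ (Fin n))) (φ : M → F) (i j : Fin n)
    (u : EuclideanSpace ℝ (Fin n)) : F :=
  partialD i (partialD j (φ ∘ e.symm)) u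
    - ∑ k, christoffel g e k i j u • partialD k (φ ∘ e.symm) u

/-- The trace, with respect to `g`, of a bilinear form with components `B i j` in the chart `e`. -/
def metricTrace (g : Metric n M) (e : OpenPartialHomeomorph M (EuclideanSpace ℝ (Fin n)))
    (B : Fin n → Fin n → F) (u : EuclideanSpace ℝ (Fin n)) : F :=
  ∑ i, ∑ j, (metricMatrix g e u)⁻¹ i j • B i j

/-! ### Laplacian, Laplace map, harmonic maps -/

/-- The Laplace operator `Δ = - trace ∇²` of `(M, g)` on real functions. -/
def laplacian (g : Metric n M) (f : M → ℝ) (p : M) : ℝ :=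
  - metricTrace g (chartAt (EuclideanSpace ℝ (Fin n)) p)
      (fun i j => secondFundFormOfMap g (chartAt (EuclideanSpace ℝ (Fin n)) p) f i j
        (chartAt (EuclideanSpace ℝ (Fin n)) p p))
      (chartAt (EuclideanSpace ℝ (Fin n)) p p)

/-- The Laplace operator of `(M, g)` acting componentwise on `𝔼ᵐ`-valued maps. -/
def vecLaplacian (g : Metric n M) (ψ : M → EuclideanSpace ℝ (Fin m)) (p : M) :
    EuclideanSpace ℝ (Fin m) :=
  WithLp.toLp 2 fun a => laplacian g (fun q => ψ q a) p

/-- The Laplace map `L = Δx` of `x : (M, g) → 𝔼ᵐ`. -/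
def laplaceMap (g : Metric n M) (x : M → EuclideanSpace ℝ (Fin m)) :
    M → EuclideanSpace ℝ (Fin m) :=
  vecLaplacian g x

/-- The tension field `τ(φ) = div(dφ) = trace ∇dφ` of a map `φ : (M, g) → 𝔼ᵐ`. -/
def tensionField (g : Metric n M) (φ : M → EuclideanSpace ℝ (Fin m)) (p : M) :
    EuclideanSpace ℝ (Fin m) :=
  metricTrace g (chartAt (EuclideanSpace ℝ (Fin n)) p)
    (fun i j => secondFundFormOfMap g (chartAt (EuclideanSpace ℝ (Fin n)) p) φ i j
      (chartAt (EuclideanSpace ℝ (Fin n)) p p))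
    (chartAt (EuclideanSpace ℝ (Fin n)) p p)

/-- A smooth map `φ : (M, g) → 𝔼ᵐ` is harmonic if its tension field vanishes identically. -/
def IsHarmonicMap (g : Metric n M) (φ : M → EuclideanSpace ℝ (Fin m)) : Prop :=
  ContMDiff (𝓡 n) (𝓡 m) ∞ φ ∧ ∀ p, tensionField g φ p = 0

/-- The map `x : (M, g) → 𝔼ᵐ` is biharmonic: `Δ²x = 0`. -/
def IsBiharmonic (g : Metric n M) (x : M → EuclideanSpace ℝ (Fin m)) : Prop :=
  ∀ p, vecLaplacian g (vecLaplacian g x) p = 0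

/-! ### Isometric immersions, mean curvature, minimality -/

/-- The differential `dx : T_pM → 𝔼ᵐ` of `x` at `p` (the model space `ℝⁿ` is `T_pM`, and `𝔼ᵐ` is
identified with its tangent spaces). -/
def differential (n : ℕ) {m : ℕ} {M : Type*} [TopologicalSpace M]
    [ChartedSpace (EuclideanSpace ℝ (Fin n)) M] (x : M → EuclideanSpace ℝ (Fin m)) (p : M) :
    EuclideanSpace ℝ (Fin n) →L[ℝ] EuclideanSpace ℝ (Fin m) :=
  mfderiv (𝓡 n) (𝓡 m) x p

/-- `x : (M, g) → 𝔼ᵐ` is a smooth isometric immersion: `⟨dx(v), dx(w)⟩ = g(v, w)`. Since `g` is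
positive definite, `dx` is then injective at every point. -/
structure IsIsometricImmersion (g : Metric n M) (x : M → EuclideanSpace ℝ (Fin m)) : Prop where
  smooth : ContMDiff (𝓡 n) (𝓡 m) ∞ x
  isometric : ∀ (p : M) (v w : TangentSpace (𝓡 n) p),
    inner ℝ (differential n x p v) (differential n x p w) = g.inner p v w

/-- The normal space of `x` at `p`, the orthogonal complement of `dx(T_pM)` in `𝔼ᵐ`. -/
def normalSpace (n : ℕ) {m : ℕ} {M : Type*} [TopologicalSpace M]
    [ChartedSpace (EuclideanSpace ℝ (Fin n)) M] (x : M → EuclideanSpace ℝ (Fin m)) (p : M) :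
    Submodule ℝ (EuclideanSpace ℝ (Fin m)) :=
  (LinearMap.range (differential n x p).toLinearMap)ᗮ

/-- The second fundamental form `h(∂ᵢ, ∂ⱼ)` at `p`, in the chart at `p`: by the Gauss formula it
is the normal component of the derivative of `dx(∂ⱼ)` in the direction of `∂ᵢ`. -/
def secondFundForm (x : M → EuclideanSpace ℝ (Fin m)) (p : M) (i j : Fin n) :
    EuclideanSpace ℝ (Fin m) :=
  (normalSpace n x p).starProjection
    (partialD i (partialD j (x ∘ (chartAt (EuclideanSpace ℝ (Fin n)) p).symm))
      (chartAt (EuclideanSpace ℝ (Fin n)) p p))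

/-- The mean curvature vector `H = (1/n) trace h`. -/
def meanCurvatureVector (g : Metric n M) (x : M → EuclideanSpace ℝ (Fin m)) (p : M) :
    EuclideanSpace ℝ (Fin m) :=
  (1 / (n : ℝ)) • metricTrace g (chartAt (EuclideanSpace ℝ (Fin n)) p) (secondFundForm x p)
    (chartAt (EuclideanSpace ℝ (Fin n)) p p)

/-- The isometric immersion `x` is minimal: its mean curvature vector vanishes identically. -/
def IsMinimal (g : Metric n M) (x : M → EuclideanSpace ℝ (Fin m)) : Prop :=
  ∀ p, meanCurvatureVector g x p = 0

end Manifold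

end LaplaceMap

end

/-! Both equivalences reduce to one local fact. Beltrami's formula (`tensionField_eq`,
`laplaceMap_eq`) says `L = -τ(x) = -2H`, so `x` is minimal iff `L = 0`. Moreover `Δ²x = ΔL = -τ(L)`,
so harmonicity of `L` and biharmonicity both give `τ(L) = 0`, and it remains to deduce `H = 0` from
this.

Work in a chart with an orthonormal frame `b 0, b 1` and unit normal `N`. Then `τ(x) = β N`, where
`β` is the trace of the second fundamental form `A`, and `τ(βN) = 0` splits into a tangential part
`2 A(∇β) + β ∇β = 0` and a normal part `tr ∇²β = β |A|²`; the Codazzi equations turn the divergence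
of `A` into `∇β`.

Suppose `∇β ≠ 0` on an open set, and take `b 0` along `∇β`. The tangential part makes `A` diagonal
with entries `-β/2` and `3β/2`. Writing `'` for the derivative along `b 0` and `q` for the
connection coefficient along `b 1`, Codazzi gives `3β' = -4βq`, Gauss gives `q' = -q² + 3β²/4`, and
the normal part gives `β'' + qβ' = 5β³/2`. These force `32q² = 63β²`; one more derivative gives `qβ²
= 0`, which is impossible (`false_of_biharmonic_of_adapted`).

Hence `dβ = 0` (`fderiv_scalarCurvTrace`), the normal part becomes `β |A|² = 0`, and so `β = 0`
(`eq_zero_of_hasTraceHessian_zero`). `HasTraceHessian` is the coordinate-independent description of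
`τ` that links the frame computation to the definitions in charts. -/

noncomputable section

namespace LaplaceMap

/-! ### Derivatives along vector fields. -/

section Calculus

variable {E F : Type*} [NormedAddCommGroup E] [NormedSpace ℝ E] [NormedAddCommGroup F]
  [NormedSpace ℝ F]

/-- The derivative of `f` along the vector field `b`. -/
def dirD (b : E → E) (f : E → F) (u : E) : F := fderiv ℝ f u (b u)

variable {W : Set E} {b c : E → E} {f g : E → F} {u : E}

lemma contDiffOn_fderiv (hW : IsOpen W) (hf : ContDiffOn ℝ ∞ f W) :
    ContDiffOn ℝ ∞ (fderiv ℝ f) W :=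
  hf.fderiv_of_isOpen hW (by simp)

lemma contDiffOn_dirD (hW : IsOpen W) (hb : ContDiffOn ℝ ∞ b W) (hf : ContDiffOn ℝ ∞ f W) :
    ContDiffOn ℝ ∞ (dirD b f) W :=
  (contDiffOn_fderiv hW hf).clm_apply hb

lemma differentiableAt_of_contDiffOn (hW : IsOpen W) (hf : ContDiffOn ℝ ∞ f W) (hu : u ∈ W) :
    DifferentiableAt ℝ f u :=
  (hf.contDiffAt (hW.mem_nhds hu)).differentiableAt (by simp)

lemma dirD_congr (hW : IsOpen W) (h : Set.EqOn f g W) (hu : u ∈ W) : dirD b f u = dirD b g u := by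
  have : f =ᶠ[nhds u] g := Filter.eventuallyEq_of_mem (hW.mem_nhds hu) h
  rw [dirD, dirD, this.fderiv_eq]

lemma dirD_of_eqOn_const (hW : IsOpen W) {k : F} (h : ∀ v ∈ W, f v = k) (hu : u ∈ W) :
    dirD b f u = 0 := by
  rw [dirD_congr hW (g := fun _ => k) h hu]
  simp [dirD]

lemma dirD_add (hf : DifferentiableAt ℝ f u) (hg : DifferentiableAt ℝ g u) :
    dirD b (fun v => f v + g v) u = dirD b f u + dirD b g u := by
  simp [dirD, fderiv_fun_add hf hg]

lemma dirD_smul {s : E → ℝ} (hs : DifferentiableAt ℝ s u) (hf : DifferentiableAt ℝ f u) :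
    dirD b (fun v => s v • f v) u = dirD b s u • f u + s u • dirD b f u := by
  simp [dirD, fderiv_fun_smul hs hf, add_comm]

lemma dirD_mul {s t : E → ℝ} (hs : DifferentiableAt ℝ s u) (ht : DifferentiableAt ℝ t u) :
    dirD b (fun v => s v * t v) u = dirD b s u * t u + s u * dirD b t u :=
  dirD_smul hs ht

lemma dirD_const_mul {s : E → ℝ} (k : ℝ) (hs : DifferentiableAt ℝ s u) :
    dirD b (fun v => k * s v) u = k * dirD b s u := by
  simp [dirD, fderiv_const_mul hs]

lemma dirD_dirD (hW : IsOpen W) (hc : ContDiffOn ℝ ∞ c W) (hf : ContDiffOn ℝ ∞ f W)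
    (hu : u ∈ W) :
    dirD b (dirD c f) u
      = fderiv ℝ (fderiv ℝ f) u (b u) (c u) + fderiv ℝ f u (fderiv ℝ c u (b u)) := by
  have h1 := differentiableAt_of_contDiffOn hW (contDiffOn_fderiv hW hf) hu
  have h2 := differentiableAt_of_contDiffOn hW hc hu
  have : fderiv ℝ (dirD c f) u = _ := fderiv_clm_apply h1 h2
  rw [dirD, this]
  simp [add_comm]

lemma fderiv_fderiv_symm (hW : IsOpen W) (hf : ContDiffOn ℝ ∞ f W) (hu : u ∈ W) (v w : E) :
    fderiv ℝ (fderiv ℝ f) u v w = fderiv ℝ (fderiv ℝ f) u w v :=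
  ((hf.contDiffAt (hW.mem_nhds hu)).isSymmSndFDerivAt
    (by simpa using (WithTop.coe_le_coe.mpr (le_top : (2 : ℕ∞) ≤ ⊤)))).eq v w

/-- The second-order terms cancel by symmetry of the second derivative, so only the Lie bracket of
`b` and `c` survives. -/
lemma dirD_commutator (hW : IsOpen W) (hb : ContDiffOn ℝ ∞ b W) (hc : ContDiffOn ℝ ∞ c W)
    (hf : ContDiffOn ℝ ∞ f W) (hu : u ∈ W) :
    dirD b (dirD c f) u - dirD c (dirD b f) u
      = fderiv ℝ f u (fderiv ℝ c u (b u) - fderiv ℝ b u (c u)) := by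
  rw [dirD_dirD hW hc hf hu, dirD_dirD hW hb hf hu, fderiv_fderiv_symm hW hf hu (b u) (c u),
    map_sub]
  abel

end Calculus

lemma dirD_inner {E F : Type*} [NormedAddCommGroup E] [NormedSpace ℝ E] [NormedAddCommGroup F]
    [InnerProductSpace ℝ F] {b : E → E} {f g : E → F} {u : E}
    (hf : DifferentiableAt ℝ f u) (hg : DifferentiableAt ℝ g u) :
    dirD b (fun v => inner ℝ (f v) (g v)) u
      = inner ℝ (dirD b f u) (g u) + inner ℝ (f u) (dirD b g u) := by
  simp only [dirD, fderiv_inner_apply ℝ hf hg]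
  ring

/-! ### Moving frames and their structure equations. -/

/-- `HasTraceHessian X f u y`: the trace of the Hessian of `f` at `u`, with respect to the metric
induced by the immersion `X`, is `y`. The vector `z` is the trace of the Christoffel symbols. -/
def HasTraceHessian {F : Type*} [NormedAddCommGroup F] [NormedSpace ℝ F]
    (X : EuclideanSpace ℝ (Fin 2) → EuclideanSpace ℝ (Fin 3))
    (f : EuclideanSpace ℝ (Fin 2) → F) (u : EuclideanSpace ℝ (Fin 2)) (y : F) : Prop :=
  ∀ (a : Fin 2 → EuclideanSpace ℝ (Fin 2)) (z : EuclideanSpace ℝ (Fin 2)),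
    Orthonormal ℝ (fun i => fderiv ℝ X u (a i)) →
    (∀ w, inner ℝ (∑ i, fderiv ℝ (fderiv ℝ X) u (a i) (a i) - fderiv ℝ X u z)
      (fderiv ℝ X u w) = 0) →
    y = ∑ i, fderiv ℝ (fderiv ℝ f) u (a i) (a i) - fderiv ℝ f u z

/-- `b` is a smooth frame on `W`, orthonormal for the metric induced by the immersion `X`, and `F`
is the orthonormal frame of `ℝ³` that consists of the images of `b` and a unit normal. -/
structure IsMovingFrame (X : EuclideanSpace ℝ (Fin 2) → EuclideanSpace ℝ (Fin 3))
    (W : Set (EuclideanSpace ℝ (Fin 2)))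
    (b : Fin 2 → EuclideanSpace ℝ (Fin 2) → EuclideanSpace ℝ (Fin 2))
    (F : Fin 3 → EuclideanSpace ℝ (Fin 2) → EuclideanSpace ℝ (Fin 3)) : Prop where
  isOpen : IsOpen W
  contDiffOn : ContDiffOn ℝ ∞ X W
  injective : ∀ u ∈ W, Function.Injective (fderiv ℝ X u)
  contDiffOn_frame : ∀ i, ContDiffOn ℝ ∞ (b i) W
  contDiffOn_normal : ContDiffOn ℝ ∞ (F 2) W
  orthonormal : ∀ u ∈ W, Orthonormal ℝ (fun i => F i u)
  eq_zero : F 0 = dirD (b 0) X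
  eq_one : F 1 = dirD (b 1) X
  normal : ∀ u ∈ W, ∀ w, inner ℝ (F 2 u) (fderiv ℝ X u w) = 0

/-- The connection coefficients `⟨D_a F_i, F_j⟩` of a moving frame. -/
def connCoeff (b : Fin 2 → EuclideanSpace ℝ (Fin 2) → EuclideanSpace ℝ (Fin 2))
    (F : Fin 3 → EuclideanSpace ℝ (Fin 2) → EuclideanSpace ℝ (Fin 3)) (a : Fin 2) (i j : Fin 3)
    (u : EuclideanSpace ℝ (Fin 2)) : ℝ :=
  inner ℝ (dirD (b a) (F i) u) (F j u)

namespace IsMovingFrame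

variable {X : EuclideanSpace ℝ (Fin 2) → EuclideanSpace ℝ (Fin 3)}
  {W : Set (EuclideanSpace ℝ (Fin 2))}
  {b : Fin 2 → EuclideanSpace ℝ (Fin 2) → EuclideanSpace ℝ (Fin 2)}
  {F : Fin 3 → EuclideanSpace ℝ (Fin 2) → EuclideanSpace ℝ (Fin 3)}
  {u : EuclideanSpace ℝ (Fin 2)}

lemma contDiffOn_F (h : IsMovingFrame X W b F) (i : Fin 3) : ContDiffOn ℝ ∞ (F i) W := by
  fin_cases i
  · exact h.eq_zero ▸ contDiffOn_dirD h.isOpen (h.contDiffOn_frame 0) h.contDiffOn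
  · exact h.eq_one ▸ contDiffOn_dirD h.isOpen (h.contDiffOn_frame 1) h.contDiffOn
  · exact h.contDiffOn_normal

lemma differentiableAt_F (h : IsMovingFrame X W b F) (i : Fin 3) (hu : u ∈ W) :
    DifferentiableAt ℝ (F i) u :=
  differentiableAt_of_contDiffOn h.isOpen (h.contDiffOn_F i) hu

lemma contDiffOn_dirD_F (h : IsMovingFrame X W b F) (a : Fin 2) (i : Fin 3) :
    ContDiffOn ℝ ∞ (dirD (b a) (F i)) W :=
  contDiffOn_dirD h.isOpen (h.contDiffOn_frame a) (h.contDiffOn_F i)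

lemma contDiffOn_connCoeff (h : IsMovingFrame X W b F) (a : Fin 2) (i j : Fin 3) :
    ContDiffOn ℝ ∞ (connCoeff b F a i j) W :=
  (h.contDiffOn_dirD_F a i).inner ℝ (h.contDiffOn_F j)

lemma differentiableAt_connCoeff (h : IsMovingFrame X W b F) (a : Fin 2) (i j : Fin 3)
    (hu : u ∈ W) : DifferentiableAt ℝ (connCoeff b F a i j) u :=
  differentiableAt_of_contDiffOn h.isOpen (h.contDiffOn_connCoeff a i j) hu

lemma inner_F (h : IsMovingFrame X W b F) (hu : u ∈ W) (i j : Fin 3) :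
    inner ℝ (F i u) (F j u) = if i = j then (1 : ℝ) else 0 :=
  orthonormal_iff_ite.mp (h.orthonormal u hu) i j

lemma exists_orthonormalBasis (h : IsMovingFrame X W b F) (hu : u ∈ W) :
    ∃ B : OrthonormalBasis (Fin 3) ℝ (EuclideanSpace ℝ (Fin 3)), ∀ i, B i = F i u := by
  have hs : ⊤ ≤ Submodule.span ℝ (Set.range fun i => F i u) :=
    ((h.orthonormal u hu).linearIndependent.span_eq_top_of_card_eq_finrank (by simp)).ge
  exact ⟨OrthonormalBasis.mk (h.orthonormal u hu) hs, fun i => by simp⟩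

lemma inner_eq_sum (h : IsMovingFrame X W b F) (hu : u ∈ W) (v w : EuclideanSpace ℝ (Fin 3)) :
    inner ℝ v w = ∑ k, inner ℝ v (F k u) * inner ℝ w (F k u) := by
  obtain ⟨B, hB⟩ := h.exists_orthonormalBasis hu
  rw [← B.sum_inner_mul_inner v w]
  simp only [hB]
  exact Finset.sum_congr rfl fun k _ => by rw [real_inner_comm w]

lemma ext_inner (h : IsMovingFrame X W b F) (hu : u ∈ W) {v w : EuclideanSpace ℝ (Fin 3)}
    (hvw : ∀ k, inner ℝ v (F k u) = inner ℝ w (F k u)) : v = w := by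
  obtain ⟨B, hB⟩ := h.exists_orthonormalBasis hu
  refine B.repr.injective (PiLp.ext fun k => ?_)
  rw [B.repr_apply_apply, B.repr_apply_apply, hB, real_inner_comm, hvw, real_inner_comm]

lemma connCoeff_antisymm (h : IsMovingFrame X W b F) (hu : u ∈ W) (a : Fin 2) (i j : Fin 3) :
    connCoeff b F a i j u = - connCoeff b F a j i u := by
  have h1 := dirD_inner (b := b a) (h.differentiableAt_F i hu) (h.differentiableAt_F j hu)
  rw [dirD_of_eqOn_const h.isOpen (fun v hv => h.inner_F hv i j) hu] at h1
  rw [connCoeff, connCoeff, real_inner_comm (F i u)]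
  linarith

lemma connCoeff_self (h : IsMovingFrame X W b F) (hu : u ∈ W) (a : Fin 2) (i : Fin 3) :
    connCoeff b F a i i u = 0 := by
  linarith [h.connCoeff_antisymm hu a i i]

/-- The product rule applied to `connCoeff b F c i j`, with the cross term expanded in the
orthonormal frame `F`. -/
lemma inner_dirD_dirD (h : IsMovingFrame X W b F) (hu : u ∈ W) (a c : Fin 2) (i j : Fin 3) :
    inner ℝ (dirD (b a) (dirD (b c) (F i)) u) (F j u)
      = dirD (b a) (connCoeff b F c i j) u
        - ∑ k, connCoeff b F c i k u * connCoeff b F a j k u := by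
  have h1 := dirD_inner (b := b a)
    (differentiableAt_of_contDiffOn h.isOpen (h.contDiffOn_dirD_F c i) hu)
    (h.differentiableAt_F j hu)
  rw [h.inner_eq_sum hu (dirD (b c) (F i) u)] at h1
  exact eq_sub_of_add_eq h1.symm

lemma fderiv_bracket (h : IsMovingFrame X W b F) (hu : u ∈ W) :
    fderiv ℝ X u (fderiv ℝ (b 1) u (b 0 u) - fderiv ℝ (b 0) u (b 1 u))
      = dirD (b 0) (F 1) u - dirD (b 1) (F 0) u := by
  rw [← dirD_commutator h.isOpen (h.contDiffOn_frame 0) (h.contDiffOn_frame 1) h.contDiffOn hu,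
    h.eq_zero, h.eq_one]

/-- The Lie bracket of `b 0` and `b 1` is mapped to a tangent vector of the surface, so its normal
component vanishes. -/
lemma connCoeff_normal_symm (h : IsMovingFrame X W b F) (hu : u ∈ W) :
    connCoeff b F 0 1 2 u = connCoeff b F 1 0 2 u := by
  have h1 := h.normal u hu (fderiv ℝ (b 1) u (b 0 u) - fderiv ℝ (b 0) u (b 1 u))
  rw [h.fderiv_bracket hu, inner_sub_right, real_inner_comm, real_inner_comm _ (F 2 u)] at h1
  simp only [connCoeff]
  linarith

lemma fderiv_frame (h : IsMovingFrame X W b F) (s t : ℝ) :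
    fderiv ℝ X u (s • b 0 u + t • b 1 u) = s • F 0 u + t • F 1 u := by
  simp [h.eq_zero, h.eq_one, dirD]

/-- Torsion-freeness of the Levi-Civita connection in the frame: since `fderiv ℝ X u` is injective,
the bracket can be read off in `ℝ³`. -/
lemma bracket (h : IsMovingFrame X W b F) (hu : u ∈ W) :
    fderiv ℝ (b 1) u (b 0 u) - fderiv ℝ (b 0) u (b 1 u)
      = (- connCoeff b F 0 0 1 u) • b 0 u + (- connCoeff b F 1 0 1 u) • b 1 u := by
  apply h.injective u hu
  rw [h.fderiv_frame, h.fderiv_bracket hu]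
  refine h.ext_inner hu fun k => ?_
  have e0 := h.connCoeff_antisymm hu 0 1 0
  have e1 := h.connCoeff_self hu 0 1
  have e2 := h.connCoeff_self hu 1 0
  have e3 := h.connCoeff_normal_symm hu
  simp only [inner_sub_left, inner_add_left, real_inner_smul_left, h.inner_F hu]
  simp only [connCoeff] at *
  fin_cases k <;> simp <;> linarith

lemma commutator (h : IsMovingFrame X W b F) (hu : u ∈ W) {G : Type*} [NormedAddCommGroup G]
    [NormedSpace ℝ G] {f : EuclideanSpace ℝ (Fin 2) → G} (hf : ContDiffOn ℝ ∞ f W) :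
    dirD (b 0) (dirD (b 1) f) u - dirD (b 1) (dirD (b 0) f) u
      = (- connCoeff b F 0 0 1 u) • dirD (b 0) f u
        + (- connCoeff b F 1 0 1 u) • dirD (b 1) f u := by
  rw [dirD_commutator h.isOpen (h.contDiffOn_frame 0) (h.contDiffOn_frame 1) hf hu, h.bracket hu]
  simp only [map_add, map_smul, dirD]

/-- The structure equations of Gauss and Codazzi. -/
lemma structure_equation (h : IsMovingFrame X W b F) (hu : u ∈ W) (i j : Fin 3) :
    dirD (b 0) (connCoeff b F 1 i j) u - dirD (b 1) (connCoeff b F 0 i j) u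
      = ∑ k, (connCoeff b F 1 i k u * connCoeff b F 0 j k u
          - connCoeff b F 0 i k u * connCoeff b F 1 j k u)
        - connCoeff b F 0 0 1 u * connCoeff b F 0 i j u
        - connCoeff b F 1 0 1 u * connCoeff b F 1 i j u := by
  -- Flatness of `ℝ³`: the commutator identity applies to the frame vector `F i` itself, viewed as a
  -- vector-valued function.
  have h1 := congrArg (fun v => inner ℝ v (F j u)) (h.commutator hu (h.contDiffOn_F i))
  simp only [inner_sub_left, inner_add_left, real_inner_smul_left, h.inner_dirD_dirD hu] at h1
  rw [Finset.sum_sub_distrib]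
  have e (a : Fin 2) : inner ℝ (dirD (b a) (F i) u) (F j u) = connCoeff b F a i j u := rfl
  rw [e, e] at h1
  linarith

/-- The vector fed to `fderiv ℝ f u` is `∑ ∇_{b i} b i` minus the flat derivatives `∑ D_{b i} b i`,
that is, the trace of the Christoffel symbols. -/
lemma sum_hessian_frame (h : IsMovingFrame X W b F) (hu : u ∈ W) {G : Type*}
    [NormedAddCommGroup G] [NormedSpace ℝ G] {f : EuclideanSpace ℝ (Fin 2) → G}
    (hf : ContDiffOn ℝ ∞ f W) :
    ∑ i, fderiv ℝ (fderiv ℝ f) u (b i u) (b i u) - fderiv ℝ f u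
      ((- connCoeff b F 1 0 1 u) • b 0 u + connCoeff b F 0 0 1 u • b 1 u
        - ∑ i, fderiv ℝ (b i) u (b i u)) =
    dirD (b 0) (dirD (b 0) f) u + dirD (b 1) (dirD (b 1) f) u
      + connCoeff b F 1 0 1 u • dirD (b 0) f u - connCoeff b F 0 0 1 u • dirD (b 1) f u := by
  rw [dirD_dirD h.isOpen (h.contDiffOn_frame 0) hf hu,
    dirD_dirD h.isOpen (h.contDiffOn_frame 1) hf hu]
  simp only [Fin.sum_univ_two, map_add, map_sub, map_smul, map_neg, dirD, neg_smul]
  abel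

/-- The trace of the Hessian of a function in terms of a moving frame. -/
lemma eq_of_hasTraceHessian (h : IsMovingFrame X W b F) (hu : u ∈ W) {G : Type*}
    [NormedAddCommGroup G] [NormedSpace ℝ G] {f : EuclideanSpace ℝ (Fin 2) → G}
    (hf : ContDiffOn ℝ ∞ f W) {y : G} (hy : HasTraceHessian X f u y) :
    y = dirD (b 0) (dirD (b 0) f) u + dirD (b 1) (dirD (b 1) f) u
      + connCoeff b F 1 0 1 u • dirD (b 0) f u - connCoeff b F 0 0 1 u • dirD (b 1) f u := by
  rw [← h.sum_hessian_frame hu hf]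
  -- The frame and the vector `z` are those of `sum_hessian_frame`; that `z` is admissible follows
  -- from the same formula with `f = X`.
  refine hy _ _ ?_ fun w => ?_
  · convert (h.orthonormal u hu).comp (Fin.castSucc : Fin 2 → Fin 3)
      (Fin.castSucc_injective 2) using 2 with i
    fin_cases i
    · simp [h.eq_zero, dirD]
    · simp [h.eq_one, dirD]
  · rw [h.sum_hessian_frame hu h.contDiffOn, ← h.eq_zero, ← h.eq_one, h.inner_eq_sum hu]
    have e0 := h.connCoeff_antisymm hu 1 1 0
    have e1 := h.connCoeff_self hu 1 1
    have e2 := h.connCoeff_self hu 0 0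
    simp only [connCoeff] at e0 e1 e2
    simp only [Fin.sum_univ_three, inner_sub_left, inner_add_left, real_inner_smul_left,
      h.inner_F hu, real_inner_comm (F 2 u) _, h.normal u hu]
    simp only [connCoeff, e0, e1, e2]
    simp

end IsMovingFrame

/-! ### The biharmonic equation in a moving frame. -/

/-- The trace of the second fundamental form of a moving frame, with respect to its normal. -/
def scalarCurvTrace (b : Fin 2 → EuclideanSpace ℝ (Fin 2) → EuclideanSpace ℝ (Fin 2))
    (F : Fin 3 → EuclideanSpace ℝ (Fin 2) → EuclideanSpace ℝ (Fin 3))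
    (u : EuclideanSpace ℝ (Fin 2)) : ℝ :=
  connCoeff b F 0 0 2 u + connCoeff b F 1 1 2 u

namespace IsMovingFrame

variable {X : EuclideanSpace ℝ (Fin 2) → EuclideanSpace ℝ (Fin 3)}
  {W : Set (EuclideanSpace ℝ (Fin 2))}
  {b : Fin 2 → EuclideanSpace ℝ (Fin 2) → EuclideanSpace ℝ (Fin 2)}
  {F : Fin 3 → EuclideanSpace ℝ (Fin 2) → EuclideanSpace ℝ (Fin 3)}
  {u : EuclideanSpace ℝ (Fin 2)}

lemma contDiffOn_scalarCurvTrace (h : IsMovingFrame X W b F) :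
    ContDiffOn ℝ ∞ (scalarCurvTrace b F) W :=
  (h.contDiffOn_connCoeff 0 0 2).add (h.contDiffOn_connCoeff 1 1 2)

/-- The tangential components of `∑ D_i F_i` cancel against the connection terms, leaving only the
normal one. -/
lemma eq_smul_normal (h : IsMovingFrame X W b F) (hu : u ∈ W) {y : EuclideanSpace ℝ (Fin 3)}
    (hy : HasTraceHessian X X u y) : y = scalarCurvTrace b F u • F 2 u := by
  rw [h.eq_of_hasTraceHessian hu h.contDiffOn hy, ← h.eq_zero, ← h.eq_one]
  refine h.ext_inner hu fun k => ?_
  have e0 := h.connCoeff_antisymm hu 1 1 0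
  have e1 := h.connCoeff_self hu 1 1
  have e2 := h.connCoeff_self hu 0 0
  simp only [inner_sub_left, inner_add_left, real_inner_smul_left, h.inner_F hu, scalarCurvTrace]
  simp only [connCoeff] at *
  fin_cases k <;> simp <;> linarith

lemma dirD_connCoeff_antisymm (h : IsMovingFrame X W b F) (hu : u ∈ W) (a c : Fin 2)
    (i j : Fin 3) : dirD (b a) (connCoeff b F c i j) u = - dirD (b a) (connCoeff b F c j i) u := by
  rw [dirD_congr h.isOpen (g := fun v => (-1) * connCoeff b F c j i v) _ hu,
    dirD_const_mul _ (h.differentiableAt_connCoeff c j i hu)]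
  · ring
  · intro v hv
    simp [h.connCoeff_antisymm hv c i j]

lemma dirD_connCoeff_normal_symm (h : IsMovingFrame X W b F) (hu : u ∈ W) (a : Fin 2) :
    dirD (b a) (connCoeff b F 0 1 2) u = dirD (b a) (connCoeff b F 1 0 2) u :=
  dirD_congr h.isOpen (fun _ hv => h.connCoeff_normal_symm hv) hu

lemma inner_dirD_dirD_smul_normal (h : IsMovingFrame X W b F) (hu : u ∈ W)
    {s : EuclideanSpace ℝ (Fin 2) → ℝ} (hs : ContDiffOn ℝ ∞ s W) (a : Fin 2) (j : Fin 3) :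
    inner ℝ (dirD (b a) (dirD (b a) (fun v => s v • F 2 v)) u) (F j u)
      = dirD (b a) (dirD (b a) s) u * (if 2 = j then 1 else 0)
        + 2 * dirD (b a) s u * connCoeff b F a 2 j u
        + s u * (dirD (b a) (connCoeff b F a 2 j) u
          - ∑ k, connCoeff b F a 2 k u * connCoeff b F a j k u) := by
  have hd {v} (hv : v ∈ W) : DifferentiableAt ℝ s v :=
    differentiableAt_of_contDiffOn h.isOpen hs hv
  have hsd := contDiffOn_dirD h.isOpen (h.contDiffOn_frame a) hs
  have h1 := differentiableAt_of_contDiffOn h.isOpen hsd hu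
  have h2 := differentiableAt_of_contDiffOn h.isOpen (h.contDiffOn_dirD_F a 2) hu
  rw [dirD_congr h.isOpen (fun v hv => dirD_smul (b := b a) (hd hv) (h.differentiableAt_F 2 hv)) hu,
    dirD_add (h1.fun_smul (h.differentiableAt_F 2 hu)) ((hd hu).fun_smul h2),
    dirD_smul h1 (h.differentiableAt_F 2 hu), dirD_smul (hd hu) h2, ← h.inner_dirD_dirD hu,
    ← h.inner_F hu]
  simp only [inner_add_left, real_inner_smul_left, connCoeff]
  ring

lemma inner_dirD_smul_normal (h : IsMovingFrame X W b F) (hu : u ∈ W)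
    {s : EuclideanSpace ℝ (Fin 2) → ℝ} (hs : ContDiffOn ℝ ∞ s W) (a : Fin 2) (j : Fin 3) :
    inner ℝ (dirD (b a) (fun v => s v • F 2 v) u) (F j u)
      = dirD (b a) s u * (if 2 = j then 1 else 0) + s u * connCoeff b F a 2 j u := by
  rw [dirD_smul (differentiableAt_of_contDiffOn h.isOpen hs hu) (h.differentiableAt_F 2 hu),
    ← h.inner_F hu]
  simp only [inner_add_left, real_inner_smul_left, connCoeff]

lemma inner_traceHessian_smul_normal (h : IsMovingFrame X W b F) (hu : u ∈ W)
    {s : EuclideanSpace ℝ (Fin 2) → ℝ} (hs : ContDiffOn ℝ ∞ s W)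
    (hy : HasTraceHessian X (fun v => s v • F 2 v) u 0) (j : Fin 3) :
    dirD (b 0) (dirD (b 0) s) u * (if 2 = j then 1 else 0)
        + 2 * dirD (b 0) s u * connCoeff b F 0 2 j u
        + s u * (dirD (b 0) (connCoeff b F 0 2 j) u
          - ∑ k, connCoeff b F 0 2 k u * connCoeff b F 0 j k u)
      + (dirD (b 1) (dirD (b 1) s) u * (if 2 = j then 1 else 0)
        + 2 * dirD (b 1) s u * connCoeff b F 1 2 j u
        + s u * (dirD (b 1) (connCoeff b F 1 2 j) u
          - ∑ k, connCoeff b F 1 2 k u * connCoeff b F 1 j k u))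
      + connCoeff b F 1 0 1 u *
        (dirD (b 0) s u * (if 2 = j then 1 else 0) + s u * connCoeff b F 0 2 j u)
      - connCoeff b F 0 0 1 u *
        (dirD (b 1) s u * (if 2 = j then 1 else 0) + s u * connCoeff b F 1 2 j u) = 0 := by
  have h1 := congrArg (fun v => inner ℝ v (F j u))
    (h.eq_of_hasTraceHessian hu (hs.smul h.contDiffOn_normal) hy)
  simp only [inner_sub_left, inner_add_left, real_inner_smul_left, inner_zero_left] at h1
  rw [← h.inner_dirD_dirD_smul_normal hu hs, ← h.inner_dirD_dirD_smul_normal hu hs,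
    ← h.inner_dirD_smul_normal hu hs, ← h.inner_dirD_smul_normal hu hs]
  exact h1.symm

lemma dirD_scalarCurvTrace (h : IsMovingFrame X W b F) (hu : u ∈ W) (a : Fin 2) :
    dirD (b a) (scalarCurvTrace b F) u
      = dirD (b a) (connCoeff b F 0 0 2) u + dirD (b a) (connCoeff b F 1 1 2) u :=
  dirD_add (h.differentiableAt_connCoeff 0 0 2 hu) (h.differentiableAt_connCoeff 1 1 2 hu)

/-- The entry `(1, 2)` of the structure equation. Antisymmetry and `connCoeff_normal_symm` leave
five independent coefficients: two for the connection and three for the second fundamental form. -/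
lemma codazzi_one (h : IsMovingFrame X W b F) (hu : u ∈ W) :
    dirD (b 0) (connCoeff b F 1 1 2) u - dirD (b 1) (connCoeff b F 0 1 2) u
      = connCoeff b F 1 0 1 u * (connCoeff b F 0 0 2 u - connCoeff b F 1 1 2 u)
        - 2 * connCoeff b F 0 0 1 u * connCoeff b F 0 1 2 u := by
  rw [h.structure_equation hu]
  simp only [Fin.sum_univ_three, h.connCoeff_self hu, h.connCoeff_antisymm hu _ 2 0,
    h.connCoeff_antisymm hu _ 2 1, h.connCoeff_antisymm hu _ 1 0,
    h.connCoeff_normal_symm hu]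
  ring

lemma codazzi_zero (h : IsMovingFrame X W b F) (hu : u ∈ W) :
    dirD (b 0) (connCoeff b F 0 1 2) u - dirD (b 1) (connCoeff b F 0 0 2) u
      = connCoeff b F 0 0 1 u * (connCoeff b F 1 1 2 u - connCoeff b F 0 0 2 u)
        - 2 * connCoeff b F 1 0 1 u * connCoeff b F 0 1 2 u := by
  rw [h.dirD_connCoeff_normal_symm hu, h.structure_equation hu]
  simp only [Fin.sum_univ_three, h.connCoeff_self hu, h.connCoeff_antisymm hu _ 2 0,
    h.connCoeff_antisymm hu _ 2 1, h.connCoeff_normal_symm hu]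
  ring

/-- The entry `(0, 1)` of the structure equation; the first two terms on the right are minus the
determinant of the second fundamental form, i.e. minus the Gauss curvature. -/
lemma gauss (h : IsMovingFrame X W b F) (hu : u ∈ W) :
    dirD (b 0) (connCoeff b F 1 0 1) u - dirD (b 1) (connCoeff b F 0 0 1) u
      = connCoeff b F 0 1 2 u ^ 2 - connCoeff b F 0 0 2 u * connCoeff b F 1 1 2 u
        - connCoeff b F 0 0 1 u ^ 2 - connCoeff b F 1 0 1 u ^ 2 := by
  rw [h.structure_equation hu]
  simp only [Fin.sum_univ_three, h.connCoeff_self hu,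
    h.connCoeff_antisymm hu _ 1 0, h.connCoeff_normal_symm hu]
  ring

/-- The first tangential component of the biharmonic equation. -/
lemma biharmonic_tangent_zero (h : IsMovingFrame X W b F) (hu : u ∈ W)
    (hy : HasTraceHessian X (fun v => scalarCurvTrace b F v • F 2 v) u 0) :
    2 * connCoeff b F 0 0 2 u * dirD (b 0) (scalarCurvTrace b F) u
      + 2 * connCoeff b F 0 1 2 u * dirD (b 1) (scalarCurvTrace b F) u
      + scalarCurvTrace b F u * dirD (b 0) (scalarCurvTrace b F) u = 0 := by
  have h1 := h.inner_traceHessian_smul_normal hu h.contDiffOn_scalarCurvTrace hy 0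
  have h2 := h.codazzi_one hu
  have h3 := h.dirD_scalarCurvTrace hu 0
  have h4 := h.dirD_connCoeff_normal_symm hu 1
  simp only [Fin.sum_univ_three, h.connCoeff_self hu, h.connCoeff_antisymm hu _ 2 0,
    h.connCoeff_antisymm hu _ 2 1, h.connCoeff_normal_symm hu,
    h.dirD_connCoeff_antisymm hu _ _ 2 0, h4, if_neg (show (2 : Fin 3) ≠ 0 by decide)] at h1 h2 ⊢
  linear_combination (-1) * h1 + scalarCurvTrace b F u * h2 + scalarCurvTrace b F u * h3

/-- The second tangential component of the biharmonic equation. -/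
lemma biharmonic_tangent_one (h : IsMovingFrame X W b F) (hu : u ∈ W)
    (hy : HasTraceHessian X (fun v => scalarCurvTrace b F v • F 2 v) u 0) :
    2 * connCoeff b F 0 1 2 u * dirD (b 0) (scalarCurvTrace b F) u
      + 2 * connCoeff b F 1 1 2 u * dirD (b 1) (scalarCurvTrace b F) u
      + scalarCurvTrace b F u * dirD (b 1) (scalarCurvTrace b F) u = 0 := by
  have h1 := h.inner_traceHessian_smul_normal hu h.contDiffOn_scalarCurvTrace hy 1
  have h2 := h.codazzi_zero hu
  have h3 := h.dirD_scalarCurvTrace hu 1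
  simp only [Fin.sum_univ_three, h.connCoeff_self hu, h.connCoeff_antisymm hu _ 2 0,
    h.connCoeff_antisymm hu _ 2 1, h.connCoeff_antisymm hu _ 1 0, h.connCoeff_normal_symm hu,
    h.dirD_connCoeff_antisymm hu _ _ 2 1, if_neg (show (2 : Fin 3) ≠ 1 by decide)] at h1 h2 ⊢
  linear_combination (-1) * h1 - scalarCurvTrace b F u * h2 + scalarCurvTrace b F u * h3

/-- The normal component of the biharmonic equation. -/
lemma biharmonic_normal (h : IsMovingFrame X W b F) (hu : u ∈ W)
    (hy : HasTraceHessian X (fun v => scalarCurvTrace b F v • F 2 v) u 0) :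
    dirD (b 0) (dirD (b 0) (scalarCurvTrace b F)) u
      + dirD (b 1) (dirD (b 1) (scalarCurvTrace b F)) u
      + connCoeff b F 1 0 1 u * dirD (b 0) (scalarCurvTrace b F) u
      - connCoeff b F 0 0 1 u * dirD (b 1) (scalarCurvTrace b F) u
      = scalarCurvTrace b F u * (connCoeff b F 0 0 2 u ^ 2 + 2 * connCoeff b F 0 1 2 u ^ 2
        + connCoeff b F 1 1 2 u ^ 2) := by
  have h1 := h.inner_traceHessian_smul_normal hu h.contDiffOn_scalarCurvTrace hy 2
  have h2 (a : Fin 2) : dirD (b a) (connCoeff b F a 2 2) u = 0 :=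
    dirD_of_eqOn_const h.isOpen (fun v hv => h.connCoeff_self hv a 2) hu
  simp only [Fin.sum_univ_three, h.connCoeff_self hu, h.connCoeff_antisymm hu _ 2 0,
    h.connCoeff_antisymm hu _ 2 1, h.connCoeff_normal_symm hu, h2, if_true] at h1 ⊢
  linear_combination h1

/-- There is no biharmonic surface whose mean curvature has no critical point. -/
lemma false_of_biharmonic_of_adapted (h : IsMovingFrame X W b F) (hu : u ∈ W)
    (hy : ∀ v ∈ W, HasTraceHessian X (fun v => scalarCurvTrace b F v • F 2 v) v 0)
    (h1 : ∀ v ∈ W, dirD (b 1) (scalarCurvTrace b F) v = 0)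
    (h0 : ∀ v ∈ W, dirD (b 0) (scalarCurvTrace b F) v ≠ 0) : False := by
  set β := scalarCurvTrace b F with hβ
  have hβs : ContDiffOn ℝ ∞ β W := h.contDiffOn_scalarCurvTrace
  have dβ {v} (hv : v ∈ W) : DifferentiableAt ℝ β v := differentiableAt_of_contDiffOn h.isOpen hβs hv
  -- As `dβ` vanishes on `b 1` but not on `b 0`, the tangential equations say that `b 0` is a
  -- principal direction with curvature `-β/2`.
  have a00 : ∀ v ∈ W, connCoeff b F 0 0 2 v = (-1 / 2) * β v := by
    intro v hv
    have := h.biharmonic_tangent_zero hv (hy v hv)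
    rw [← hβ, h1 v hv] at this
    have := mul_left_cancel₀ (h0 v hv) (b := 2 * connCoeff b F 0 0 2 v + β v) (c := 0) (by linarith)
    linarith
  have a01 : ∀ v ∈ W, connCoeff b F 0 1 2 v = 0 := by
    intro v hv
    have := h.biharmonic_tangent_one hv (hy v hv)
    rw [← hβ, h1 v hv] at this
    have := mul_left_cancel₀ (h0 v hv) (b := 2 * connCoeff b F 0 1 2 v) (c := 0) (by linarith)
    linarith
  have a11 : ∀ v ∈ W, connCoeff b F 1 1 2 v = (3 / 2) * β v := by
    intro v hv
    have : β v = connCoeff b F 0 0 2 v + connCoeff b F 1 1 2 v := rfl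
    linarith [a00 v hv]
  have d00 (a : Fin 2) {v} (hv : v ∈ W) :
      dirD (b a) (connCoeff b F 0 0 2) v = (-1 / 2) * dirD (b a) β v := by
    rw [dirD_congr h.isOpen a00 hv, dirD_const_mul _ (dβ hv)]
  have d11 (a : Fin 2) {v} (hv : v ∈ W) :
      dirD (b a) (connCoeff b F 1 1 2) v = (3 / 2) * dirD (b a) β v := by
    rw [dirD_congr h.isOpen a11 hv, dirD_const_mul _ (dβ hv)]
  have d01 (a : Fin 2) {v} (hv : v ∈ W) : dirD (b a) (connCoeff b F 0 1 2) v = 0 :=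
    dirD_of_eqOn_const h.isOpen a01 hv
  set q := connCoeff b F 1 0 1
  have dq {v} (hv : v ∈ W) : DifferentiableAt ℝ q v := h.differentiableAt_connCoeff 1 0 1 hv
  have E1 : ∀ v ∈ W, 3 * dirD (b 0) β v = (-4) * (β v * q v) := by
    intro v hv
    have := h.codazzi_one hv
    rw [d11 0 hv, d01 1 hv, a00 v hv, a01 v hv, a11 v hv] at this
    linarith
  have β0 : ∀ v ∈ W, β v ≠ 0 := fun v hv e => h0 v hv (by have := E1 v hv; rw [e] at this; linarith)
  have q0 : ∀ v ∈ W, q v ≠ 0 := fun v hv e => h0 v hv (by have := E1 v hv; rw [e] at this; linarith)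
  have p0 : ∀ v ∈ W, connCoeff b F 0 0 1 v = 0 := by
    intro v hv
    have := h.codazzi_zero hv
    rw [d00 1 hv, d01 0 hv, a00 v hv, a01 v hv, a11 v hv, h1 v hv] at this
    exact (mul_eq_zero.mp (show connCoeff b F 0 0 1 v * β v = 0 by linarith)).resolve_right (β0 v hv)
  have E2 : ∀ v ∈ W, dirD (b 0) q v = - q v ^ 2 + 3 / 4 * β v ^ 2 := by
    intro v hv
    have := h.gauss hv
    rw [dirD_of_eqOn_const h.isOpen p0 hv, a00 v hv, a01 v hv, a11 v hv, p0 v hv] at this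
    linear_combination this
  have E3 : ∀ v ∈ W, dirD (b 0) (dirD (b 0) β) v + q v * dirD (b 0) β v = 5 / 2 * β v ^ 3 := by
    intro v hv
    have := h.biharmonic_normal hv (hy v hv)
    rw [← hβ, dirD_of_eqOn_const h.isOpen h1 hv, a00 v hv, a01 v hv, a11 v hv, p0 v hv] at this
    linear_combination this
  -- Differentiate `E1` along `b 0`, then eliminate the second derivative of `β` by `E3`, that of
  -- `q` by `E2` and the remaining first derivative by `E1`; a factor `β` cancels.
  have E4 : ∀ v ∈ W, 32 * (q v * q v) = 63 * (β v * β v) := by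
    intro v hv
    have hd : dirD (b 0) (fun v => 3 * dirD (b 0) β v) v
        = dirD (b 0) (fun v => (-4) * (β v * q v)) v := dirD_congr h.isOpen E1 hv
    rw [dirD_const_mul _ (differentiableAt_of_contDiffOn h.isOpen
      (contDiffOn_dirD h.isOpen (h.contDiffOn_frame 0) hβs) hv),
      dirD_const_mul _ ((dβ hv).fun_mul (dq hv)), dirD_mul (dβ hv) (dq hv)] at hd
    have e1 := E1 v hv
    have e2 := E2 v hv
    have e3 := E3 v hv
    refine mul_left_cancel₀ (β0 v hv) ?_
    linear_combination (18 : ℝ) * e3 - 6 * hd + 24 * β v * e2 + 2 * q v * e1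
  have E5 := dirD_congr (b := b 0) (f := fun v => 32 * (q v * q v))
    (g := fun v => 63 * (β v * β v)) h.isOpen E4 hu
  rw [dirD_const_mul _ ((dq hu).fun_mul (dq hu)), dirD_const_mul _ ((dβ hu).fun_mul (dβ hu)),
    dirD_mul (dβ hu) (dβ hu), dirD_mul (dq hu) (dq hu), E2 u hu] at E5
  have e1 := E1 u hu
  have e4 := E4 u hu
  -- The derivative of `E4` becomes `216 qβ² = 64 q³`, while `E4` gives `64 q³ = 126 qβ²`; hence `90
  -- qβ² = 0`.
  have E6 : q u * (β u * β u) = 0 := by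
    linear_combination (1 / 90 : ℝ) * E5 + (42 / 90) * β u * e1 + (2 / 90) * q u * e4
  exact mul_ne_zero (q0 u hu) (mul_ne_zero (β0 u hu) (β0 u hu)) E6

end IsMovingFrame

/-! ### Existence of frames and the local theorem. -/

section Surface

lemma HasTraceHessian.congr {F : Type*} [NormedAddCommGroup F] [NormedSpace ℝ F]
    {X : EuclideanSpace ℝ (Fin 2) → EuclideanSpace ℝ (Fin 3)}
    {f g : EuclideanSpace ℝ (Fin 2) → F} {W : Set (EuclideanSpace ℝ (Fin 2))}
    {u : EuclideanSpace ℝ (Fin 2)} {y : F} (h : HasTraceHessian X f u y) (hW : IsOpen W)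
    (hu : u ∈ W) (hfg : Set.EqOn f g W) : HasTraceHessian X g u y := by
  have e : f =ᶠ[nhds u] g := Filter.eventuallyEq_of_mem (hW.mem_nhds hu) hfg
  intro a z ha hz
  rw [h a z ha hz, e.fderiv.fderiv_eq, e.fderiv_eq]

/-- The cross product on Euclidean space. -/
def euclideanCross (v w : EuclideanSpace ℝ (Fin 3)) : EuclideanSpace ℝ (Fin 3) :=
  !₂[v 1 * w 2 - v 2 * w 1, v 2 * w 0 - v 0 * w 2, v 0 * w 1 - v 1 * w 0]

lemma inner_euclideanCross_left (v w : EuclideanSpace ℝ (Fin 3)) :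
    inner ℝ (euclideanCross v w) v = 0 := by
  simp [euclideanCross, PiLp.inner_apply, Fin.sum_univ_three]
  ring

lemma inner_euclideanCross_right (v w : EuclideanSpace ℝ (Fin 3)) :
    inner ℝ (euclideanCross v w) w = 0 := by
  simp [euclideanCross, PiLp.inner_apply, Fin.sum_univ_three]
  ring

lemma inner_euclideanCross_self (v w : EuclideanSpace ℝ (Fin 3)) :
    inner ℝ (euclideanCross v w) (euclideanCross v w)
      = inner ℝ v v * inner ℝ w w - inner ℝ v w ^ 2 := by
  simp only [euclideanCross, PiLp.inner_apply, Fin.sum_univ_three]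
  simp
  ring

lemma contDiffOn_euclideanCross {E : Type*} [NormedAddCommGroup E] [NormedSpace ℝ E]
    {f g : E → EuclideanSpace ℝ (Fin 3)} {W : Set E} (hf : ContDiffOn ℝ ∞ f W)
    (hg : ContDiffOn ℝ ∞ g W) : ContDiffOn ℝ ∞ (fun u => euclideanCross (f u) (g u)) W := by
  rw [contDiffOn_euclidean] at *
  intro i
  fin_cases i
  · exact ((hf 1).mul (hg 2)).sub ((hf 2).mul (hg 1))
  · exact ((hf 2).mul (hg 0)).sub ((hf 0).mul (hg 2))
  · exact ((hf 0).mul (hg 1)).sub ((hf 1).mul (hg 0))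

lemma eq_smul_add_smul_of_linearIndependent {a : Fin 2 → EuclideanSpace ℝ (Fin 2)}
    (ha : LinearIndependent ℝ a) (v : EuclideanSpace ℝ (Fin 2)) :
    ∃ s t : ℝ, v = s • a 0 + t • a 1 := by
  have h1 := ha.span_eq_top_of_card_eq_finrank (by simp)
  have h2 : v ∈ Submodule.span ℝ (Set.range a) := h1 ▸ Submodule.mem_top
  obtain ⟨c, hc⟩ := (Submodule.mem_span_range_iff_exists_fun ℝ).mp h2
  exact ⟨c 0, c 1, by rw [← hc, Fin.sum_univ_two]⟩

lemma eq_smul_single_add_smul_single (v : EuclideanSpace ℝ (Fin 2)) :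
    v = v 0 • EuclideanSpace.single 0 (1 : ℝ) + v 1 • EuclideanSpace.single 1 (1 : ℝ) := by
  ext i
  fin_cases i <;> simp

variable {X : EuclideanSpace ℝ (Fin 2) → EuclideanSpace ℝ (Fin 3)}
  {W : Set (EuclideanSpace ℝ (Fin 2))} {u : EuclideanSpace ℝ (Fin 2)}

/-- Every nonvanishing vector field is the second field of an orthogonal frame, up to scaling. -/
lemma exists_orthonormal_frame (hW : IsOpen W) (hX : ContDiffOn ℝ ∞ X W)
    (hinj : ∀ u ∈ W, Function.Injective (fderiv ℝ X u))
    {k : EuclideanSpace ℝ (Fin 2) → EuclideanSpace ℝ (Fin 2)} (hk : ContDiffOn ℝ ∞ k W)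
    (hk0 : ∀ u ∈ W, k u ≠ 0) :
    ∃ b : Fin 2 → EuclideanSpace ℝ (Fin 2) → EuclideanSpace ℝ (Fin 2),
      (∀ i, ContDiffOn ℝ ∞ (b i) W) ∧
      (∀ u ∈ W, Orthonormal ℝ (fun i => fderiv ℝ X u (b i u))) ∧
      ∀ u, ∃ r : ℝ, b 1 u = r • k u := by
  let e (i : Fin 2) : EuclideanSpace ℝ (Fin 2) := EuclideanSpace.single i 1
  let G (i : Fin 2) (u : EuclideanSpace ℝ (Fin 2)) : ℝ :=
    inner ℝ (fderiv ℝ X u (k u)) (fderiv ℝ X u (e i))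
  have hD := contDiffOn_fderiv hW hX
  have hG (i : Fin 2) : ContDiffOn ℝ ∞ (G i) W :=
    (hD.clm_apply hk).inner ℝ (hD.clm_apply contDiffOn_const)
  -- Rotating the covector `⟨dX k, dX ·⟩` by a right angle gives a field orthogonal to `k` in the
  -- induced metric. It vanishes only if `dX k` is orthogonal to the whole tangent plane.
  let m (u : EuclideanSpace ℝ (Fin 2)) : EuclideanSpace ℝ (Fin 2) :=
    (- G 1 u) • e 0 + G 0 u • e 1
  have hm : ContDiffOn ℝ ∞ m W :=
    ((hG 1).neg.smul contDiffOn_const).add ((hG 0).smul contDiffOn_const)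
  have hkm (u) : inner ℝ (fderiv ℝ X u (k u)) (fderiv ℝ X u (m u)) = 0 := by
    simp only [m, map_add, map_smul, inner_add_right, real_inner_smul_right]
    simp only [G]
    ring
  have hDk : ∀ u ∈ W, fderiv ℝ X u (k u) ≠ 0 := fun u hu =>
    (map_ne_zero_iff _ (hinj u hu)).mpr (hk0 u hu)
  have hm0 : ∀ u ∈ W, m u ≠ 0 := by
    intro u hu h0
    have h1 : G 1 u = 0 := by simpa [m, e] using congrArg (fun v => v 0) h0
    have h2 : G 0 u = 0 := by simpa [m, e] using congrArg (fun v => v 1) h0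
    apply hDk u hu
    rw [← inner_self_eq_zero (𝕜 := ℝ)]
    nth_rw 2 [eq_smul_single_add_smul_single (k u)]
    simp only [map_add, map_smul, inner_add_right, real_inner_smul_right]
    change k u 0 * G 0 u + k u 1 * G 1 u = 0
    rw [h1, h2]
    ring
  have hDm : ∀ u ∈ W, fderiv ℝ X u (m u) ≠ 0 := fun u hu =>
    (map_ne_zero_iff _ (hinj u hu)).mpr (hm0 u hu)
  have hnorm {v : EuclideanSpace ℝ (Fin 2) → EuclideanSpace ℝ (Fin 2)} (hv : ContDiffOn ℝ ∞ v W)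
      (hv0 : ∀ u ∈ W, fderiv ℝ X u (v u) ≠ 0) :
      ContDiffOn ℝ ∞ (fun u => ‖fderiv ℝ X u (v u)‖⁻¹ • v u) W :=
    (((hD.clm_apply hv).norm ℝ hv0).inv fun u hu => norm_ne_zero_iff.mpr (hv0 u hu)).smul hv
  refine ⟨![fun u => ‖fderiv ℝ X u (m u)‖⁻¹ • m u, fun u => ‖fderiv ℝ X u (k u)‖⁻¹ • k u],
    ?_, ?_, fun u => ⟨_, rfl⟩⟩
  · intro i
    fin_cases i
    · exact hnorm hm hDm
    · exact hnorm hk hDk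
  · intro u hu
    have n1 := norm_ne_zero_iff.mpr (hDm u hu)
    have n2 := norm_ne_zero_iff.mpr (hDk u hu)
    constructor
    · intro i
      fin_cases i <;> simp [norm_smul, n1, n2]
    · intro i j hij
      fin_cases i <;> fin_cases j <;>
        simp [real_inner_smul_left, real_inner_smul_right, hkm,
          real_inner_comm (fderiv ℝ X u (k u))] at hij ⊢

lemma isMovingFrame_of_normal (hW : IsOpen W) (hX : ContDiffOn ℝ ∞ X W)
    (hinj : ∀ u ∈ W, Function.Injective (fderiv ℝ X u))
    {b : Fin 2 → EuclideanSpace ℝ (Fin 2) → EuclideanSpace ℝ (Fin 2)}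
    (hb : ∀ i, ContDiffOn ℝ ∞ (b i) W)
    (hbo : ∀ u ∈ W, Orthonormal ℝ (fun i => fderiv ℝ X u (b i u)))
    {N : EuclideanSpace ℝ (Fin 2) → EuclideanSpace ℝ (Fin 3)} (hN : ContDiffOn ℝ ∞ N W)
    (hN1 : ∀ u ∈ W, ‖N u‖ = 1) (hN0 : ∀ u ∈ W, ∀ w, inner ℝ (N u) (fderiv ℝ X u w) = 0) :
    IsMovingFrame X W b ![dirD (b 0) X, dirD (b 1) X, N] where
  isOpen := hW
  contDiffOn := hX
  injective := hinj
  contDiffOn_frame := hb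
  contDiffOn_normal := hN
  orthonormal u hu := by
    have h0 := (hbo u hu).1 0
    have h1 := (hbo u hu).1 1
    have h2 := (hbo u hu).2 (show (0 : Fin 2) ≠ 1 by decide)
    have h3 := (hbo u hu).2 (show (1 : Fin 2) ≠ 0 by decide)
    constructor
    · intro i
      fin_cases i
      · exact h0
      · exact h1
      · exact hN1 u hu
    · intro i j hij
      fin_cases i <;> fin_cases j
      · exact absurd rfl hij
      · exact h2
      · exact (real_inner_comm _ _).trans (hN0 u hu _)
      · exact h3
      · exact absurd rfl hij
      · exact (real_inner_comm _ _).trans (hN0 u hu _)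
      · exact hN0 u hu _
      · exact hN0 u hu _
      · exact absurd rfl hij
  eq_zero := rfl
  eq_one := rfl
  normal := hN0

lemma linearIndependent_of_orthonormal_fderiv {a : Fin 2 → EuclideanSpace ℝ (Fin 2)}
    (h : Orthonormal ℝ (fun i => fderiv ℝ X u (a i))) : LinearIndependent ℝ a :=
  LinearIndependent.of_comp (fderiv ℝ X u).toLinearMap h.linearIndependent

/-- A constant coordinate field seeds the tangent frame; the cross product supplies the normal, of
unit length by Lagrange's identity. -/
lemma exists_isMovingFrame (hW : IsOpen W) (hX : ContDiffOn ℝ ∞ X W)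
    (hinj : ∀ u ∈ W, Function.Injective (fderiv ℝ X u)) :
    ∃ b F, IsMovingFrame X W b F := by
  obtain ⟨b, hb, hbo, -⟩ := exists_orthonormal_frame hW hX hinj
    (k := fun _ => EuclideanSpace.single 0 (1 : ℝ)) contDiffOn_const (by simp)
  refine ⟨b, _, isMovingFrame_of_normal hW hX hinj hb hbo
    (N := fun u => euclideanCross (dirD (b 0) X u) (dirD (b 1) X u))
    (contDiffOn_euclideanCross (contDiffOn_dirD hW (hb 0) hX) (contDiffOn_dirD hW (hb 1) hX))
    (fun u hu => ?_) (fun u hu w => ?_)⟩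
  · have h0 : ‖dirD (b 0) X u‖ = 1 := (hbo u hu).1 0
    have h1 : ‖dirD (b 1) X u‖ = 1 := (hbo u hu).1 1
    have h2 : inner ℝ (dirD (b 0) X u) (dirD (b 1) X u) = 0 :=
      (hbo u hu).2 (show (0 : Fin 2) ≠ 1 by decide)
    have h3 := inner_euclideanCross_self (dirD (b 0) X u) (dirD (b 1) X u)
    rw [h2, real_inner_self_eq_norm_sq, real_inner_self_eq_norm_sq, real_inner_self_eq_norm_sq,
      h0, h1] at h3
    nlinarith [norm_nonneg (euclideanCross (dirD (b 0) X u) (dirD (b 1) X u))]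
  · obtain ⟨s, t, rfl⟩ := eq_smul_add_smul_of_linearIndependent
      (linearIndependent_of_orthonormal_fderiv (hbo u hu)) w
    have h1 := inner_euclideanCross_left (dirD (b 0) X u) (dirD (b 1) X u)
    have h2 := inner_euclideanCross_right (dirD (b 0) X u) (dirD (b 1) X u)
    simp only [map_add, map_smul, inner_add_right, real_inner_smul_right]
    rw [dirD, dirD] at *
    rw [h1, h2]
    ring

/-- Smoothness is read off from `Y = β N`, whose two factors are smooth. -/
lemma contDiffOn_of_hasTraceHessian (hW : IsOpen W) (hX : ContDiffOn ℝ ∞ X W)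
    (hinj : ∀ u ∈ W, Function.Injective (fderiv ℝ X u))
    {Y : EuclideanSpace ℝ (Fin 2) → EuclideanSpace ℝ (Fin 3)}
    (hY : ∀ u ∈ W, HasTraceHessian X X u (Y u)) : ContDiffOn ℝ ∞ Y W := by
  obtain ⟨b, F, h⟩ := exists_isMovingFrame hW hX hinj
  exact (h.contDiffOn_scalarCurvTrace.smul h.contDiffOn_normal).congr
    fun u hu => h.eq_smul_normal hu (hY u hu)

/-- A biharmonic surface has constant mean curvature. -/
lemma IsMovingFrame.fderiv_scalarCurvTrace
    {b : Fin 2 → EuclideanSpace ℝ (Fin 2) → EuclideanSpace ℝ (Fin 2)}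
    {F : Fin 3 → EuclideanSpace ℝ (Fin 2) → EuclideanSpace ℝ (Fin 3)} (h : IsMovingFrame X W b F)
    (hX2 : ∀ v ∈ W, HasTraceHessian X X v (scalarCurvTrace b F v • F 2 v))
    (hy : ∀ v ∈ W, HasTraceHessian X (fun v => scalarCurvTrace b F v • F 2 v) v 0) (hu : u ∈ W) :
    fderiv ℝ (scalarCurvTrace b F) u = 0 := by
  by_contra hne
  set s := scalarCurvTrace b F with hs
  have hss : ContDiffOn ℝ ∞ s W := h.contDiffOn_scalarCurvTrace
  have hds := contDiffOn_fderiv h.isOpen hss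
  set U := W ∩ (fderiv ℝ s) ⁻¹' {0}ᶜ with hU
  have hUo : IsOpen U := hds.continuousOn.isOpen_inter_preimage h.isOpen isOpen_compl_singleton
  have hUW : U ⊆ W := Set.inter_subset_left
  have hdU := hds.mono hUW
  let e (i : Fin 2) : EuclideanSpace ℝ (Fin 2) := EuclideanSpace.single i 1
  -- The differential of `s` rotated by a right angle spans its kernel, so a frame whose second
  -- field is along `k` is adapted to the level curves of `s`.
  let k (v : EuclideanSpace ℝ (Fin 2)) : EuclideanSpace ℝ (Fin 2) :=
    (- fderiv ℝ s v (e 1)) • e 0 + fderiv ℝ s v (e 0) • e 1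
  have hk : ContDiffOn ℝ ∞ k U :=
    ((hdU.clm_apply contDiffOn_const).neg.smul contDiffOn_const).add
      ((hdU.clm_apply contDiffOn_const).smul contDiffOn_const)
  have hk0 : ∀ v ∈ U, k v ≠ 0 := by
    intro v hv h0
    have h1 : fderiv ℝ s v (e 1) = 0 := by simpa [k, e] using congrArg (fun v => v 0) h0
    have h2 : fderiv ℝ s v (e 0) = 0 := by simpa [k, e] using congrArg (fun v => v 1) h0
    refine hv.2 (ContinuousLinearMap.ext fun w => ?_)
    rw [eq_smul_single_add_smul_single w, map_add, map_smul, map_smul]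
    change w 0 • fderiv ℝ s v (e 0) + w 1 • fderiv ℝ s v (e 1) = 0
    simp [h1, h2]
  have hsk (v) : fderiv ℝ s v (k v) = 0 := by
    simp only [k, map_add, map_smul, smul_eq_mul]
    ring
  have hXU := h.contDiffOn.mono hUW
  have hinjU := fun v (hv : v ∈ U) => h.injective v (hUW hv)
  obtain ⟨c, hc, hco, hcr⟩ := exists_orthonormal_frame hUo hXU hinjU hk hk0
  have h' := isMovingFrame_of_normal hUo hXU hinjU hc hco (h.contDiffOn_normal.mono hUW)
    (fun v hv => (h.orthonormal v (hUW hv)).1 2) (fun v hv => h.normal v (hUW hv))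
  have hF2 (v) : (![dirD (c 0) X, dirD (c 1) X, F 2] : Fin 3 → _) 2 v = F 2 v := rfl
  set F' : Fin 3 → _ := ![dirD (c 0) X, dirD (c 1) X, F 2] with hF'
  -- The new frame keeps the old normal, and the trace of the Hessian of `X` is the same multiple of
  -- it in either frame.
  have hss' : Set.EqOn s (scalarCurvTrace c F') U := by
    intro v hv
    have h1 := h'.eq_smul_normal hv (hX2 v (hUW hv))
    have hn : F 2 v ≠ 0 := (h.orthonormal v (hUW hv)).ne_zero 2
    exact smul_left_injective ℝ hn h1
  have hd (i : Fin 2) {v} (hv : v ∈ U) :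
      dirD (c i) (scalarCurvTrace c F') v = fderiv ℝ s v (c i v) :=
    (dirD_congr hUo hss' hv).symm
  have hc1 : ∀ v ∈ U, fderiv ℝ s v (c 1 v) = 0 := by
    intro v hv
    obtain ⟨r, hr⟩ := hcr v
    rw [hr, map_smul, hsk, smul_zero]
  refine h'.false_of_biharmonic_of_adapted (u := u) ⟨hu, hne⟩ (fun v hv => ?_) (fun v hv => ?_)
    fun v hv h0 => hv.2 (ContinuousLinearMap.ext fun w => ?_)
  · exact (hy v (hUW hv)).congr hUo hv fun w hw => by simp only [hF2, hss' hw]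
  · rw [hd 1 hv, hc1 v hv]
  · rw [hd 0 hv] at h0
    obtain ⟨s', t, rfl⟩ := eq_smul_add_smul_of_linearIndependent
      (linearIndependent_of_orthonormal_fderiv (hco v hv)) w
    rw [map_add, map_smul, map_smul, h0, hc1 v hv]
    simp

/-- A biharmonic surface in Euclidean space is minimal, in coordinates. -/
theorem eq_zero_of_hasTraceHessian_zero (hW : IsOpen W) (hX : ContDiffOn ℝ ∞ X W)
    (hinj : ∀ u ∈ W, Function.Injective (fderiv ℝ X u))
    {Y : EuclideanSpace ℝ (Fin 2) → EuclideanSpace ℝ (Fin 3)}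
    (hY : ∀ u ∈ W, HasTraceHessian X X u (Y u)) (hYY : ∀ u ∈ W, HasTraceHessian X Y u 0)
    (hu : u ∈ W) : Y u = 0 := by
  obtain ⟨b, F, h⟩ := exists_isMovingFrame hW hX hinj
  have e : Set.EqOn Y (fun v => scalarCurvTrace b F v • F 2 v) W :=
    fun v hv => h.eq_smul_normal hv (hY v hv)
  have hy : ∀ v ∈ W, HasTraceHessian X (fun v => scalarCurvTrace b F v • F 2 v) v 0 :=
    fun v hv => (hYY v hv).congr hW hv e
  have hd : ∀ v ∈ W, fderiv ℝ (scalarCurvTrace b F) v = 0 := fun v hv =>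
    h.fderiv_scalarCurvTrace (fun v hv => by simpa only [e hv] using hY v hv) hy hv
  have hd1 (i : Fin 2) : ∀ v ∈ W, dirD (b i) (scalarCurvTrace b F) v = 0 :=
    fun v hv => by simp [dirD, hd v hv]
  have h1 := h.biharmonic_normal hu (hy u hu)
  rw [dirD_of_eqOn_const hW (hd1 0) hu, dirD_of_eqOn_const hW (hd1 1) hu, hd1 0 u hu,
    hd1 1 u hu] at h1
  -- With `β` locally constant the normal equation reads `β |A|² = 0`; if `|A|² = 0`, the trace of
  -- `A` vanishes as well.
  have hs : scalarCurvTrace b F u = 0 := by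
    rcases mul_eq_zero.mp (h1.symm.trans (by ring)) with h2 | h2
    · exact h2
    · have e0 : connCoeff b F 0 0 2 u = 0 := by
        rw [← sq_eq_zero_iff]
        nlinarith [sq_nonneg (connCoeff b F 0 0 2 u), sq_nonneg (connCoeff b F 0 1 2 u),
          sq_nonneg (connCoeff b F 1 1 2 u)]
      have e1 : connCoeff b F 1 1 2 u = 0 := by
        rw [← sq_eq_zero_iff]
        nlinarith [sq_nonneg (connCoeff b F 0 0 2 u), sq_nonneg (connCoeff b F 0 1 2 u),
          sq_nonneg (connCoeff b F 1 1 2 u)]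
      rw [scalarCurvTrace, e0, e1, add_zero]
  rw [e hu]
  simp [hs]

end Surface

/-! ### Change of coordinates. -/

lemma fderiv_comp_of_contDiffOn {E E' F : Type*} [NormedAddCommGroup E] [NormedSpace ℝ E]
    [NormedAddCommGroup E'] [NormedSpace ℝ E'] [NormedAddCommGroup F] [NormedSpace ℝ F]
    {f : E' → F} {T : E → E'} {V : Set E'} {V' : Set E} {u : E} (hV : IsOpen V) (hV' : IsOpen V')
    (hf : ContDiffOn ℝ ∞ f V) (hT : ContDiffOn ℝ ∞ T V') (hTV : Set.MapsTo T V' V) (hu : u ∈ V') :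
    fderiv ℝ (f ∘ T) u = (fderiv ℝ f (T u)).comp (fderiv ℝ T u) :=
  fderiv_comp u (differentiableAt_of_contDiffOn hV hf (hTV hu))
    (differentiableAt_of_contDiffOn hV' hT hu)

lemma fderiv_fderiv_comp {E E' F : Type*} [NormedAddCommGroup E] [NormedSpace ℝ E]
    [NormedAddCommGroup E'] [NormedSpace ℝ E'] [NormedAddCommGroup F] [NormedSpace ℝ F]
    {f : E' → F} {T : E → E'} {V : Set E'} {V' : Set E} {u : E} (hV : IsOpen V) (hV' : IsOpen V')
    (hf : ContDiffOn ℝ ∞ f V) (hT : ContDiffOn ℝ ∞ T V') (hTV : Set.MapsTo T V' V) (hu : u ∈ V')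
    (v w : E) :
    fderiv ℝ (fderiv ℝ (f ∘ T)) u v w
      = fderiv ℝ (fderiv ℝ f) (T u) (fderiv ℝ T u v) (fderiv ℝ T u w)
        + fderiv ℝ f (T u) (fderiv ℝ (fderiv ℝ T) u v w) := by
  have e : fderiv ℝ (f ∘ T) =ᶠ[nhds u] fun v => ((fderiv ℝ f ∘ T) v).comp (fderiv ℝ T v) :=
    Filter.eventuallyEq_of_mem (hV'.mem_nhds hu)
      fun v hv => fderiv_comp_of_contDiffOn hV hV' hf hT hTV hv
  have hf' := contDiffOn_fderiv hV hf
  have hT' := contDiffOn_fderiv hV' hT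
  rw [e.fderiv_eq, fderiv_clm_comp
    (differentiableAt_of_contDiffOn hV' (hf'.comp hT hTV) hu)
    (differentiableAt_of_contDiffOn hV' hT' hu), fderiv_comp_of_contDiffOn hV hV' hf' hT hTV hu]
  simp [add_comm]

/-- The trace of the Hessian does not depend on the coordinates. -/
lemma HasTraceHessian.of_comp {F : Type*} [NormedAddCommGroup F] [NormedSpace ℝ F]
    {X X' : EuclideanSpace ℝ (Fin 2) → EuclideanSpace ℝ (Fin 3)}
    {f f' : EuclideanSpace ℝ (Fin 2) → F} {T : EuclideanSpace ℝ (Fin 2) → EuclideanSpace ℝ (Fin 2)}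
    {V V' : Set (EuclideanSpace ℝ (Fin 2))} {u : EuclideanSpace ℝ (Fin 2)} {y : F}
    (hV : IsOpen V) (hV' : IsOpen V') (hX : ContDiffOn ℝ ∞ X V) (hf : ContDiffOn ℝ ∞ f V)
    (hT : ContDiffOn ℝ ∞ T V') (hTV : Set.MapsTo T V' V) (hu : u ∈ V')
    (hXX : Set.EqOn X' (X ∘ T) V') (hff : Set.EqOn f' (f ∘ T) V')
    (hinj : Function.Injective (fderiv ℝ X' u)) (h : HasTraceHessian X' f' u y) :
    HasTraceHessian X f (T u) y := by
  have eX : X' =ᶠ[nhds u] X ∘ T := Filter.eventuallyEq_of_mem (hV'.mem_nhds hu) hXX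
  have ef : f' =ᶠ[nhds u] f ∘ T := Filter.eventuallyEq_of_mem (hV'.mem_nhds hu) hff
  unfold HasTraceHessian at h
  rw [eX.fderiv.fderiv_eq, eX.fderiv_eq, ef.fderiv.fderiv_eq, ef.fderiv_eq] at h
  rw [eX.fderiv_eq] at hinj
  have dX := fderiv_comp_of_contDiffOn hV hV' hX hT hTV hu
  have df := fderiv_comp_of_contDiffOn hV hV' hf hT hTV hu
  have ddX := fderiv_fderiv_comp hV hV' hX hT hTV hu
  have ddf := fderiv_fderiv_comp hV hV' hf hT hTV hu
  rw [dX] at hinj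
  have hTs : Function.Surjective (fderiv ℝ T u) := by
    refine (LinearMap.injective_iff_surjective (f := (fderiv ℝ T u).toLinearMap)).mp ?_
    exact Function.Injective.of_comp (f := fderiv ℝ X (T u)) hinj
  intro a z ha hz
  choose R hR using hTs
  -- The second derivative of `T` is the inhomogeneous term in the transformation law of the
  -- Christoffel symbols; it cancels the extra term of the second-order chain rule.
  have h1 := h (fun i => R (a i)) (R (z + ∑ i, fderiv ℝ (fderiv ℝ T) u (R (a i)) (R (a i))))
  simp only [dX, df, ddX, ddf, ContinuousLinearMap.comp_apply, hR] at h1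
  rw [h1 ha]
  · rw [Finset.sum_add_distrib, map_add, map_sum]
    abel
  · intro w
    rw [← hz (fderiv ℝ T u w), Finset.sum_add_distrib, map_add, map_sum]
    congr 1
    abel

lemma partialD_eq_fderiv {n : ℕ} {F : Type*} [NormedAddCommGroup F] [NormedSpace ℝ F]
    (i : Fin n) (f : EuclideanSpace ℝ (Fin n) → F) (u : EuclideanSpace ℝ (Fin n)) :
    partialD i f u = fderiv ℝ f u (EuclideanSpace.single i 1) := rfl

lemma contDiffOn_partialD {n : ℕ} {F : Type*} [NormedAddCommGroup F] [NormedSpace ℝ F]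
    {f : EuclideanSpace ℝ (Fin n) → F} {W : Set (EuclideanSpace ℝ (Fin n))} (hW : IsOpen W)
    (hf : ContDiffOn ℝ ∞ f W) (i : Fin n) : ContDiffOn ℝ ∞ (partialD i f) W :=
  contDiffOn_dirD (b := fun _ => EuclideanSpace.single i 1) hW contDiffOn_const hf

lemma partialD_partialD {n : ℕ} {F : Type*} [NormedAddCommGroup F] [NormedSpace ℝ F]
    {f : EuclideanSpace ℝ (Fin n) → F} {W : Set (EuclideanSpace ℝ (Fin n))} (hW : IsOpen W)
    (hf : ContDiffOn ℝ ∞ f W) {u : EuclideanSpace ℝ (Fin n)} (hu : u ∈ W) (i j : Fin n) :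
    partialD i (partialD j f) u
      = fderiv ℝ (fderiv ℝ f) u (EuclideanSpace.single i 1) (EuclideanSpace.single j 1) := by
  have := dirD_dirD (b := fun _ => EuclideanSpace.single i 1)
    (c := fun _ => EuclideanSpace.single j 1) hW contDiffOn_const hf hu
  rw [fderiv_fun_const, Pi.zero_apply, zero_apply, map_zero, add_zero] at this
  exact this

/-! ### Metric, Christoffel symbols and Laplacian in a chart. -/

section Chart

variable {n m : ℕ} {M : Type*} [TopologicalSpace M]
  [ChartedSpace (EuclideanSpace ℝ (Fin n)) M] [IsManifold (𝓡 n) ∞ M]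
  {g : Metric n M} {e : OpenPartialHomeomorph M (EuclideanSpace ℝ (Fin n))}
  {u : EuclideanSpace ℝ (Fin n)}

lemma contDiffOn_comp_symm {x : M → EuclideanSpace ℝ (Fin m)} (hx : ContMDiff (𝓡 n) (𝓡 m) ∞ x)
    (he : e ∈ atlas (EuclideanSpace ℝ (Fin n)) M) : ContDiffOn ℝ ∞ (x ∘ e.symm) e.target := by
  rw [← contMDiffOn_iff_contDiffOn]
  exact hx.comp_contMDiffOn (contMDiffOn_symm_of_mem_maximalAtlas
    (IsManifold.subset_maximalAtlas he))

lemma contDiffOn_transition {e' : OpenPartialHomeomorph M (EuclideanSpace ℝ (Fin n))}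
    (he : e ∈ atlas (EuclideanSpace ℝ (Fin n)) M) (he' : e' ∈ atlas (EuclideanSpace ℝ (Fin n)) M) :
    ContDiffOn ℝ ∞ (e ∘ e'.symm) (e'.symm.trans e).source := by
  rw [← contMDiffOn_iff_contDiffOn]
  have h1 : ContMDiffOn (𝓡 n) (𝓡 n) ∞ e e.source :=
    contMDiffOn_of_mem_maximalAtlas (IsManifold.subset_maximalAtlas he)
  have h2 : ContMDiffOn (𝓡 n) (𝓡 n) ∞ e'.symm e'.target :=
    contMDiffOn_symm_of_mem_maximalAtlas (IsManifold.subset_maximalAtlas he')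
  simpa using h1.comp' h2

lemma mdifferentiable_of_mem_atlas_smooth (he : e ∈ atlas (EuclideanSpace ℝ (Fin n)) M) :
    e.MDifferentiable (𝓡 n) (𝓡 n) :=
  haveI : IsManifold (𝓡 n) 1 M := IsManifold.of_le (n := ∞) (by simp)
  mdifferentiable_of_mem_atlas he

/-- The derivative of the inverse of a chart. -/
def chartSymmDeriv (e : OpenPartialHomeomorph M (EuclideanSpace ℝ (Fin n)))
    (u : EuclideanSpace ℝ (Fin n)) : EuclideanSpace ℝ (Fin n) →L[ℝ] EuclideanSpace ℝ (Fin n) :=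
  mfderiv (𝓡 n) (𝓡 n) e.symm u

lemma chartSymmDeriv_bijective (he : e ∈ atlas (EuclideanSpace ℝ (Fin n)) M) (hu : u ∈ e.target) :
    Function.Bijective (chartSymmDeriv e u) :=
  (mdifferentiable_of_mem_atlas_smooth he).symm.mfderiv_bijective hu

lemma fderiv_comp_symm {x : M → EuclideanSpace ℝ (Fin m)} (hx : ContMDiff (𝓡 n) (𝓡 m) ∞ x)
    (he : e ∈ atlas (EuclideanSpace ℝ (Fin n)) M) (hu : u ∈ e.target)
    (v : EuclideanSpace ℝ (Fin n)) :
    fderiv ℝ (x ∘ e.symm) u v = differential n x (e.symm u) (chartSymmDeriv e u v) := by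
  rw [← mfderiv_eq_fderiv]
  have h1 : MDifferentiableAt (𝓡 n) (𝓡 m) x (e.symm u) := (hx.mdifferentiable (by simp)) _
  have h2 := (mdifferentiable_of_mem_atlas_smooth he).mdifferentiableAt_symm hu
  rw [mfderiv_comp u h1 h2]
  rfl

namespace IsIsometricImmersion

variable {x : M → EuclideanSpace ℝ (Fin m)}

lemma metricMatrix_apply (hx : IsIsometricImmersion g x)
    (he : e ∈ atlas (EuclideanSpace ℝ (Fin n)) M) (hu : u ∈ e.target) (i j : Fin n) :
    metricMatrix g e u i j
      = inner ℝ (partialD i (x ∘ e.symm) u) (partialD j (x ∘ e.symm) u) := by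
  rw [partialD_eq_fderiv, partialD_eq_fderiv, fderiv_comp_symm hx.smooth he hu,
    fderiv_comp_symm hx.smooth he hu]
  exact (hx.isometric (e.symm u) (coordVector e u i) (coordVector e u j)).symm

lemma injective_differential (hx : IsIsometricImmersion g x) (p : M) :
    Function.Injective (differential n x p) := by
  rw [injective_iff_map_eq_zero]
  intro v hv
  by_contra hne
  have h1 := hx.isometric p v v
  rw [hv, inner_zero_left] at h1
  exact (g.pos p v hne).ne h1

lemma injective_fderiv (hx : IsIsometricImmersion g x)
    (he : e ∈ atlas (EuclideanSpace ℝ (Fin n)) M) (hu : u ∈ e.target) :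
    Function.Injective (fderiv ℝ (x ∘ e.symm) u) := by
  have : ⇑(fderiv ℝ (x ∘ e.symm) u) = differential n x (e.symm u) ∘ chartSymmDeriv e u :=
    funext fun v => fderiv_comp_symm hx.smooth he hu v
  rw [this]
  exact (hx.injective_differential _).comp (chartSymmDeriv_bijective he hu).1

lemma range_fderiv (hx : IsIsometricImmersion g x)
    (he : e ∈ atlas (EuclideanSpace ℝ (Fin n)) M) (hu : u ∈ e.target) :
    LinearMap.range (differential n x (e.symm u)).toLinearMap
      = LinearMap.range (fderiv ℝ (x ∘ e.symm) u).toLinearMap := by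
  ext y
  constructor
  · rintro ⟨v, rfl⟩
    obtain ⟨w, rfl⟩ := (chartSymmDeriv_bijective he hu).2 v
    exact ⟨w, fderiv_comp_symm hx.smooth he hu w⟩
  · rintro ⟨v, rfl⟩
    exact ⟨_, (fderiv_comp_symm hx.smooth he hu v).symm⟩

lemma partialD_metricMatrix (hx : IsIsometricImmersion g x)
    (he : e ∈ atlas (EuclideanSpace ℝ (Fin n)) M) (hu : u ∈ e.target) (k i j : Fin n) :
    partialD k (fun v => metricMatrix g e v i j) u
      = inner ℝ (partialD k (partialD i (x ∘ e.symm)) u) (partialD j (x ∘ e.symm) u)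
        + inner ℝ (partialD i (x ∘ e.symm) u) (partialD k (partialD j (x ∘ e.symm)) u) := by
  have hX := contDiffOn_comp_symm hx.smooth he
  have hd (i : Fin n) : DifferentiableAt ℝ (partialD i (x ∘ e.symm)) u :=
    differentiableAt_of_contDiffOn e.open_target (contDiffOn_partialD e.open_target hX i) hu
  have h1 := dirD_congr (b := fun _ => EuclideanSpace.single k (1 : ℝ)) e.open_target
    (fun v hv => hx.metricMatrix_apply he hv i j) hu
  exact h1.trans (dirD_inner (hd i) (hd j))

/-- The Gauss formula: the second fundamental form of an isometric immersion, as a map, is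
normal. -/
lemma inner_secondFundFormOfMap (hx : IsIsometricImmersion g x)
    (he : e ∈ atlas (EuclideanSpace ℝ (Fin n)) M) (hu : u ∈ e.target)
    (hG : (metricMatrix g e u)⁻¹ * metricMatrix g e u = 1) (i j l : Fin n) :
    inner ℝ (secondFundFormOfMap g e x i j u) (partialD l (x ∘ e.symm) u) = 0 := by
  have hX := contDiffOn_comp_symm hx.smooth he
  have hsymm (i j : Fin n) : partialD i (partialD j (x ∘ e.symm)) u
      = partialD j (partialD i (x ∘ e.symm)) u := by
    rw [partialD_partialD e.open_target hX hu, partialD_partialD e.open_target hX hu,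
      fderiv_fderiv_symm e.open_target hX hu]
  -- After differentiating `g_{ij} = ⟨∂ᵢX, ∂ⱼX⟩`, four of the six inner products cancel in pairs and
  -- the other two equal `⟨∂ᵢ∂ⱼX, ∂ₗX⟩`.
  have hc (k : Fin n) : christoffel g e k i j u = ∑ l, (metricMatrix g e u)⁻¹ k l *
      inner ℝ (partialD i (partialD j (x ∘ e.symm)) u) (partialD l (x ∘ e.symm) u) := by
    rw [christoffel, Finset.mul_sum]
    refine Finset.sum_congr rfl fun l _ => ?_
    rw [hx.partialD_metricMatrix he hu, hx.partialD_metricMatrix he hu,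
      hx.partialD_metricMatrix he hu, hsymm l i, hsymm l j, hsymm j i,
      real_inner_comm (partialD i (partialD l (x ∘ e.symm)) u) (partialD j (x ∘ e.symm) u)]
    ring
  have hs : (metricMatrix g e u).transpose = metricMatrix g e u := by
    ext i j
    rw [Matrix.transpose_apply, hx.metricMatrix_apply he hu, hx.metricMatrix_apply he hu,
      real_inner_comm]
  rw [secondFundFormOfMap, inner_sub_left, sum_inner, sub_eq_zero]
  simp only [real_inner_smul_left, ← hx.metricMatrix_apply he hu, hc, Finset.sum_mul]
  rw [Finset.sum_comm]
  have h1 (k : Fin n) : ∑ i, (metricMatrix g e u)⁻¹ i k * metricMatrix g e u i l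
      = if k = l then 1 else 0 := by
    have h2 : ((metricMatrix g e u)⁻¹).transpose * metricMatrix g e u = 1 := by
      rw [Matrix.transpose_nonsing_inv, hs, hG]
    rw [← Matrix.one_apply, ← h2, Matrix.mul_apply]
    rfl
  have h3 (k : Fin n) (c : ℝ) : ∑ i, (metricMatrix g e u)⁻¹ i k * c * metricMatrix g e u i l
      = c * ∑ i, (metricMatrix g e u)⁻¹ i k * metricMatrix g e u i l := by
    rw [Finset.mul_sum]
    exact Finset.sum_congr rfl fun i _ => by ring
  simp only [h3, h1]
  simp

end IsIsometricImmersion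

lemma secondFundFormOfMap_eq {φ : M → EuclideanSpace ℝ (Fin m)}
    (hφ : ContDiffOn ℝ ∞ (φ ∘ e.symm) e.target) (hu : u ∈ e.target) (i j : Fin n) :
    secondFundFormOfMap g e φ i j u
      = fderiv ℝ (fderiv ℝ (φ ∘ e.symm)) u (EuclideanSpace.single i 1) (EuclideanSpace.single j 1)
        - fderiv ℝ (φ ∘ e.symm) u
          (∑ k, christoffel g e k i j u • EuclideanSpace.single k (1 : ℝ)) := by
  rw [secondFundFormOfMap, partialD_partialD e.open_target hφ hu, map_sum]
  simp only [map_smul, partialD_eq_fderiv]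

/-- Coordinate projections are linear, so they commute with partial derivatives wherever the map is
differentiable. -/
lemma vecLaplacian_eq_neg_tensionField {φ : M → EuclideanSpace ℝ (Fin m)} {p : M}
    (hφ : ContDiffOn ℝ ∞ (φ ∘ (chartAt (EuclideanSpace ℝ (Fin n)) p).symm)
      (chartAt (EuclideanSpace ℝ (Fin n)) p).target) :
    vecLaplacian g φ p = - tensionField g φ p := by
  set e := chartAt (EuclideanSpace ℝ (Fin n)) p with he
  have hu : e p ∈ e.target := mem_chart_target _ p
  have hc {f : EuclideanSpace ℝ (Fin n) → EuclideanSpace ℝ (Fin m)}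
      (hf : ContDiffOn ℝ ∞ f e.target) (a : Fin m) (i : Fin n) :
      ∀ v ∈ e.target, partialD i (fun w => f w a) v = partialD i f v a := by
    intro v hv
    have h1 := (EuclideanSpace.proj a : EuclideanSpace ℝ (Fin m) →L[ℝ] ℝ).hasFDerivAt.comp v
      (differentiableAt_of_contDiffOn e.open_target hf hv).hasFDerivAt
    have h2 : fderiv ℝ (fun w => f w a) v = _ := h1.fderiv
    rw [partialD, h2]
    rfl
  ext a
  have h2 (i j : Fin n) : secondFundFormOfMap g e (fun q => φ q a) i j (e p)
      = secondFundFormOfMap g e φ i j (e p) a := by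
    have h1 (j : Fin n) : ∀ v ∈ e.target, partialD j ((fun q => φ q a) ∘ e.symm) v
        = partialD j (φ ∘ e.symm) v a := hc hφ a j
    have h3 : partialD i (partialD j ((fun q => φ q a) ∘ e.symm)) (e p)
        = partialD i (partialD j (φ ∘ e.symm)) (e p) a := by
      rw [← hc (contDiffOn_partialD e.open_target hφ j) a i _ hu]
      exact dirD_congr (b := fun _ => EuclideanSpace.single i (1 : ℝ)) e.open_target (h1 j) hu
    simp only [secondFundFormOfMap, h3, h1 _ _ hu]
    simp
  change laplacian g (fun q => φ q a) p = _
  simp only [laplacian, tensionField, metricTrace, ← he, h2]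
  simp

end Chart

/-! ### Surfaces: from charts to the manifold. -/

section Manifold

variable {M : Type*} [TopologicalSpace M]
  [ChartedSpace (EuclideanSpace ℝ (Fin 2)) M] [IsManifold (𝓡 2) ∞ M]
  {g : Metric 2 M} {x : M → EuclideanSpace ℝ (Fin 3)}
  {e : OpenPartialHomeomorph M (EuclideanSpace ℝ (Fin 2))} {u : EuclideanSpace ℝ (Fin 2)}

namespace IsIsometricImmersion

/-- The inverse of the metric matrix in terms of an orthonormal frame. -/
lemma metricMatrix_mul (hx : IsIsometricImmersion g x)
    (he : e ∈ atlas (EuclideanSpace ℝ (Fin 2)) M) (hu : u ∈ e.target)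
    {a : Fin 2 → EuclideanSpace ℝ (Fin 2)}
    (ha : Orthonormal ℝ (fun i => fderiv ℝ (x ∘ e.symm) u (a i))) :
    metricMatrix g e u * Matrix.of (fun i j => ∑ k, a k i * a k j) = 1 := by
  let A : Matrix (Fin 2) (Fin 2) ℝ := Matrix.of fun i k => a k i
  have hA : Matrix.of (fun i j => ∑ k, a k i * a k j) = A * A.transpose := by
    ext i j
    simp [A, Matrix.mul_apply]
  -- The columns of `A` are the frame vectors, so orthonormality reads `Aᵀ G A = 1`, whence `G⁻¹ = A
  -- Aᵀ`.
  have h1 : A.transpose * (metricMatrix g e u * A) = 1 := by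
    ext k l
    rw [Matrix.one_apply, ← orthonormal_iff_ite.mp ha k l,
      eq_smul_single_add_smul_single (a k), eq_smul_single_add_smul_single (a l)]
    simp only [map_add, map_smul, inner_add_left, inner_add_right, real_inner_smul_left,
      real_inner_smul_right, ← partialD_eq_fderiv, ← hx.metricMatrix_apply he hu,
      Matrix.mul_apply, Fin.sum_univ_two, Matrix.transpose_apply, A, Matrix.of_apply]
    ring
  rw [hA, ← mul_assoc]
  exact mul_eq_one_comm.mp h1

lemma exists_orthonormal (hx : IsIsometricImmersion g x)
    (he : e ∈ atlas (EuclideanSpace ℝ (Fin 2)) M) (hu : u ∈ e.target) :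
    ∃ a : Fin 2 → EuclideanSpace ℝ (Fin 2),
      Orthonormal ℝ (fun i => fderiv ℝ (x ∘ e.symm) u (a i)) := by
  obtain ⟨b, -, hb, -⟩ := exists_orthonormal_frame e.open_target
    (contDiffOn_comp_symm hx.smooth he) (fun u hu => hx.injective_fderiv he hu)
    (k := fun _ => EuclideanSpace.single 0 (1 : ℝ)) contDiffOn_const (by simp)
  exact ⟨_, hb u hu⟩

lemma inner_secondFundFormOfMap_fderiv (hx : IsIsometricImmersion g x)
    (he : e ∈ atlas (EuclideanSpace ℝ (Fin 2)) M) (hu : u ∈ e.target) (i j : Fin 2)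
    (w : EuclideanSpace ℝ (Fin 2)) :
    inner ℝ (secondFundFormOfMap g e x i j u) (fderiv ℝ (x ∘ e.symm) u w) = 0 := by
  obtain ⟨a, ha⟩ := hx.exists_orthonormal he hu
  have h1 := hx.metricMatrix_mul he hu ha
  have h2 := hx.inner_secondFundFormOfMap he hu
    (by rw [Matrix.inv_eq_right_inv h1, mul_eq_one_comm, h1]) i j
  rw [eq_smul_single_add_smul_single w]
  simp only [map_add, map_smul, inner_add_right, real_inner_smul_right, ← partialD_eq_fderiv, h2]
  simp

/-- The trace of the second fundamental form of a map, computed in a chart. -/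
lemma hasTraceHessian_metricTrace (hx : IsIsometricImmersion g x)
    (he : e ∈ atlas (EuclideanSpace ℝ (Fin 2)) M) (hu : u ∈ e.target) {m : ℕ}
    {φ : M → EuclideanSpace ℝ (Fin m)} (hφ : ContDiffOn ℝ ∞ (φ ∘ e.symm) e.target) :
    HasTraceHessian (x ∘ e.symm) (φ ∘ e.symm) u
      (metricTrace g e (fun i j => secondFundFormOfMap g e φ i j u) u) := by
  intro a z ha hz
  let Γ (i j : Fin 2) : EuclideanSpace ℝ (Fin 2) :=
    ∑ k, christoffel g e k i j u • EuclideanSpace.single k (1 : ℝ)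
  let z₀ : EuclideanSpace ℝ (Fin 2) := ∑ i, ∑ j, (∑ k, a k i * a k j) • Γ i j
  have key {m : ℕ} {φ : M → EuclideanSpace ℝ (Fin m)}
      (hφ : ContDiffOn ℝ ∞ (φ ∘ e.symm) e.target) :
      ∑ i, ∑ j, (∑ k, a k i * a k j) • secondFundFormOfMap g e φ i j u
        = ∑ k, fderiv ℝ (fderiv ℝ (φ ∘ e.symm)) u (a k) (a k)
          - fderiv ℝ (φ ∘ e.symm) u z₀ := by
    have h1 (k : Fin 2) : fderiv ℝ (fderiv ℝ (φ ∘ e.symm)) u (a k) (a k)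
        = ∑ i, ∑ j, (a k i * a k j) • fderiv ℝ (fderiv ℝ (φ ∘ e.symm)) u
          (EuclideanSpace.single i 1) (EuclideanSpace.single j 1) := by
      conv_lhs => rw [eq_smul_single_add_smul_single (a k)]
      simp only [map_add, map_smul, Fin.sum_univ_two, add_apply, smul_apply]
      module
    simp only [h1, secondFundFormOfMap_eq hφ hu, z₀, Γ, map_sum, map_smul, smul_sub,
      Finset.sum_sub_distrib]
    congr 1
    simp only [Fin.sum_univ_two]
    module
  -- Both vectors make the trace normal to the surface, so `dX (z₀ - z)` is at once tangent and
  -- normal, hence zero.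
  have hz₀ : z₀ = z := by
    have h1 (w) : inner ℝ (∑ k, fderiv ℝ (fderiv ℝ (x ∘ e.symm)) u (a k) (a k)
        - fderiv ℝ (x ∘ e.symm) u z₀) (fderiv ℝ (x ∘ e.symm) u w) = 0 := by
      rw [← key (contDiffOn_comp_symm hx.smooth he)]
      simp only [sum_inner, real_inner_smul_left, hx.inner_secondFundFormOfMap_fderiv he hu]
      simp
    apply hx.injective_fderiv he hu
    rw [← sub_eq_zero, ← map_sub, ← inner_self_eq_zero (𝕜 := ℝ)]
    nth_rw 1 [map_sub]
    have h2 := h1 (z₀ - z)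
    have h3 := hz (z₀ - z)
    rw [inner_sub_left] at h2 h3 ⊢
    linarith
  rw [metricTrace, Matrix.inv_eq_right_inv (hx.metricMatrix_mul he hu ha)]
  simp only [Matrix.of_apply]
  rw [key hφ, hz₀]

/-- The tension field of a map, computed in an arbitrary chart. -/
lemma hasTraceHessian_tensionField (hx : IsIsometricImmersion g x)
    (he : e ∈ atlas (EuclideanSpace ℝ (Fin 2)) M) (hu : u ∈ e.target) {m : ℕ}
    {φ : M → EuclideanSpace ℝ (Fin m)}
    (hφ : ∀ e ∈ atlas (EuclideanSpace ℝ (Fin 2)) M, ContDiffOn ℝ ∞ (φ ∘ e.symm) e.target) :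
    HasTraceHessian (x ∘ e.symm) (φ ∘ e.symm) u (tensionField g φ (e.symm u)) := by
  set q := e.symm u with hq
  set e' := chartAt (EuclideanSpace ℝ (Fin 2)) q
  have he' : e' ∈ atlas (EuclideanSpace ℝ (Fin 2)) M := chart_mem_atlas _ q
  have hqs : q ∈ e'.source := mem_chart_source _ q
  have hqt : e' q ∈ e'.target := mem_chart_target _ q
  have hqe : q ∈ e.source := e.map_target hu
  have h1 := hx.hasTraceHessian_metricTrace he' hqt (hφ e' he')
  have hTu : (e ∘ e'.symm) (e' q) = u := by
    rw [Function.comp_apply, e'.left_inv hqs, hq, e.right_inv hu]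
  have hTV : Set.MapsTo (e ∘ e'.symm) (e'.symm.trans e).source e.target := by
    intro v hv
    rw [OpenPartialHomeomorph.trans_source] at hv
    exact e.map_source hv.2
  have hmem : e' q ∈ (e'.symm.trans e).source := by
    rw [OpenPartialHomeomorph.trans_source]
    refine ⟨hqt, ?_⟩
    rw [Set.mem_preimage, e'.left_inv hqs]
    exact hqe
  have hcomp {G : Type} (f : M → G) :
      Set.EqOn (f ∘ e'.symm) ((f ∘ e.symm) ∘ (e ∘ e'.symm)) (e'.symm.trans e).source := by
    intro v hv
    rw [OpenPartialHomeomorph.trans_source] at hv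
    simp only [Function.comp_apply]
    rw [e.left_inv hv.2]
  -- The tension field at `q` is defined in the preferred chart at `q`; the transition map carries
  -- it to the given chart `e`.
  have h2 := h1.of_comp e.open_target (e'.symm.trans e).open_source
    (contDiffOn_comp_symm hx.smooth he) (hφ e he) (contDiffOn_transition he he') hTV hmem
    (hcomp x) (hcomp φ) (hx.injective_fderiv he' hqt)
  rw [hTu] at h2
  exact h2

lemma contDiffOn_comp_symm_self (hx : IsIsometricImmersion g x) :
    ∀ e ∈ atlas (EuclideanSpace ℝ (Fin 2)) M, ContDiffOn ℝ ∞ (x ∘ e.symm) e.target :=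
  fun _ he => contDiffOn_comp_symm hx.smooth he

lemma laplaceMap_eq (hx : IsIsometricImmersion g x) (p : M) :
    laplaceMap g x p = - tensionField g x p :=
  vecLaplacian_eq_neg_tensionField (hx.contDiffOn_comp_symm_self _ (chart_mem_atlas _ p))

/-- The chart in the definition of `L` changes with the point, so smoothness is not immediate;
`hasTraceHessian_tensionField` describes the values throughout a single chart. -/
lemma contDiffOn_laplaceMap (hx : IsIsometricImmersion g x) :
    ∀ e ∈ atlas (EuclideanSpace ℝ (Fin 2)) M,
      ContDiffOn ℝ ∞ (laplaceMap g x ∘ e.symm) e.target := by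
  intro e he
  have h1 := contDiffOn_of_hasTraceHessian e.open_target (hx.contDiffOn_comp_symm_self e he)
    (fun u hu => hx.injective_fderiv he hu) (Y := tensionField g x ∘ e.symm)
    (fun u hu => hx.hasTraceHessian_tensionField he hu hx.contDiffOn_comp_symm_self)
  exact h1.neg.congr fun u _ => hx.laplaceMap_eq _

/-- Beltrami's formula `Δx = -2H`, in terms of the tension field. -/
lemma tensionField_eq (hx : IsIsometricImmersion g x) (p : M) :
    tensionField g x p = (2 : ℝ) • meanCurvatureVector g x p := by
  set e := chartAt (EuclideanSpace ℝ (Fin 2)) p with hep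
  have he : e ∈ atlas (EuclideanSpace ℝ (Fin 2)) M := chart_mem_atlas _ p
  have hu : e p ∈ e.target := mem_chart_target _ p
  have hr := hx.range_fderiv he hu
  rw [e.left_inv (mem_chart_source _ p)] at hr
  have h1 (i j : Fin 2) : secondFundForm x p i j = secondFundFormOfMap g e x i j (e p) := by
    rw [secondFundForm, ← hep]
    -- `∂ᵢ∂ⱼX` is the second fundamental form of the map, which is normal, plus the Christoffel
    -- combination of the `∂ₖX`, which is tangent.
    refine Submodule.eq_starProjection_of_mem_orthogonal' (z :=
      ∑ k, christoffel g e k i j (e p) • partialD k (x ∘ e.symm) (e p)) ?_ ?_ ?_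
    · rw [normalSpace, hr, Submodule.mem_orthogonal']
      rintro _ ⟨w, rfl⟩
      exact hx.inner_secondFundFormOfMap_fderiv he hu i j w
    · rw [normalSpace]
      refine Submodule.le_orthogonal_orthogonal _ ?_
      rw [hr]
      exact Submodule.sum_mem _ fun k _ => Submodule.smul_mem _ _ ⟨_, rfl⟩
    · rw [secondFundFormOfMap]
      abel
  rw [meanCurvatureVector, smul_smul, tensionField, ← hep]
  have : secondFundForm x p = fun i j => secondFundFormOfMap g e x i j (e p) := by
    ext1 i; ext1 j; exact h1 i j
  rw [this]
  norm_num

lemma isMinimal_iff (hx : IsIsometricImmersion g x) :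
    IsMinimal g x ↔ ∀ p, laplaceMap g x p = 0 := by
  refine forall_congr' fun p => ?_
  rw [hx.laplaceMap_eq, hx.tensionField_eq, neg_eq_zero, smul_eq_zero]
  simp

lemma isMinimal_of_tensionField_laplaceMap (hx : IsIsometricImmersion g x)
    (h : ∀ p, tensionField g (laplaceMap g x) p = 0) : IsMinimal g x := by
  rw [hx.isMinimal_iff]
  intro p
  set e := chartAt (EuclideanSpace ℝ (Fin 2)) p
  have he : e ∈ atlas (EuclideanSpace ℝ (Fin 2)) M := chart_mem_atlas _ p
  have hu : e p ∈ e.target := mem_chart_target _ p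
  have h1 := eq_zero_of_hasTraceHessian_zero e.open_target (hx.contDiffOn_comp_symm_self e he)
    (fun u hu => hx.injective_fderiv he hu) (Y := tensionField g x ∘ e.symm)
    (fun u hu => hx.hasTraceHessian_tensionField he hu hx.contDiffOn_comp_symm_self)
    (fun u hu => ?_) hu
  · rw [Function.comp_apply, e.left_inv (mem_chart_source _ p)] at h1
    rw [hx.laplaceMap_eq, h1, neg_zero]
  -- The local theorem is stated for `Y = τ(x)`, whereas the hypothesis concerns `L = -τ(x)`; the
  -- trace of the Hessian is linear, so the sign is harmless.
  · have h2 := hx.hasTraceHessian_tensionField he hu hx.contDiffOn_laplaceMap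
    rw [h] at h2
    have h3 : laplaceMap g x ∘ e.symm = - (tensionField g x ∘ e.symm) :=
      funext fun v => hx.laplaceMap_eq _
    rw [h3] at h2
    have h4 : fderiv ℝ (-(tensionField g x ∘ e.symm)) = -fderiv ℝ (tensionField g x ∘ e.symm) :=
      funext fun v => fderiv_neg
    intro a z ha hz
    have h5 := h2 a z ha hz
    rw [h4, fderiv_neg] at h5
    simp only [Pi.neg_apply, neg_apply, Finset.sum_neg_distrib] at h5
    rw [← neg_eq_zero.mpr h5.symm]
    abel

end IsIsometricImmersion

lemma tensionField_zero {m : ℕ} (p : M) :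
    tensionField g (fun _ => (0 : EuclideanSpace ℝ (Fin m))) p = 0 := by
  have h (i : Fin 2) (e : OpenPartialHomeomorph M (EuclideanSpace ℝ (Fin 2))) :
      partialD i ((fun _ => (0 : EuclideanSpace ℝ (Fin m))) ∘ e.symm) = fun _ => 0 := by
    funext u
    simp [partialD, Function.comp_def]
  have h' (i : Fin 2) (u) :
      partialD i (fun _ : EuclideanSpace ℝ (Fin 2) => (0 : EuclideanSpace ℝ (Fin m))) u = 0 := by
    simp [partialD]
  simp only [tensionField, metricTrace, secondFundFormOfMap, h, h']
  simp

end Manifold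

end LaplaceMap
end

/-- The Laplace map of a surface in `𝔼³` is harmonic if and only if the surface is minimal, and
equally the surface is biharmonic if and only if it is minimal. -/
theorem mainTheorem5 {M : Type*} [TopologicalSpace M]
    [ChartedSpace (EuclideanSpace ℝ (Fin 2)) M] [IsManifold (𝓡 2) ∞ M]
    (g : LaplaceMap.Metric 2 M) (x : M → EuclideanSpace ℝ (Fin 3))
    (hx : LaplaceMap.IsIsometricImmersion g x) :
    (LaplaceMap.IsHarmonicMap g (LaplaceMap.laplaceMap g x) ↔ LaplaceMap.IsMinimal g x) ∧
      (LaplaceMap.IsBiharmonic g x ↔ LaplaceMap.IsMinimal g x) := by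
  have hL (p : M) : LaplaceMap.vecLaplacian g (LaplaceMap.laplaceMap g x) p
      = - LaplaceMap.tensionField g (LaplaceMap.laplaceMap g x) p :=
    LaplaceMap.vecLaplacian_eq_neg_tensionField
      (hx.contDiffOn_laplaceMap _ (chart_mem_atlas _ p))
  have h0 (h : LaplaceMap.IsMinimal g x) : LaplaceMap.laplaceMap g x = fun _ => 0 :=
    funext (hx.isMinimal_iff.mp h)
  have ht (h : LaplaceMap.IsMinimal g x) (p : M) :
      LaplaceMap.tensionField g (LaplaceMap.laplaceMap g x) p = 0 := by
    rw [h0 h, LaplaceMap.tensionField_zero]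
  refine ⟨⟨fun h => hx.isMinimal_of_tensionField_laplaceMap h.2, fun h => ⟨?_, ht h⟩⟩,
    ⟨fun h => hx.isMinimal_of_tensionField_laplaceMap fun p => ?_, fun h p => ?_⟩⟩
  · rw [h0 h]
    exact contMDiff_const
  · exact neg_eq_zero.mp ((hL p).symm.trans (h p))
  · exact (hL p).trans (by rw [ht h, neg_zero])
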